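/- Let $G=(V,E,F)$ be a (finite) cell decomposition of an oriented topological torus $S$, with universal cover $(\tilde V,\tilde E,\tilde F)$. Let $\gamma_1,\gamma_2$ be positively oriented generators of $\pi_1(S)$, acting on the universal cover by deck transformations, and let $c:E\to\mathbb R_{>0}$ be positive edge weights. For $\tau\in\mathbb H=\{\operatorname{Im}\tau>0\}$ let $S_\tau$ be the unit-area Euclidean torus on which $\gamma_1,\gamma_2$ act by the translations $z\mapsto z+\frac{1}{\sqrt{\operatorname{Im}\tau}}$ and $z\mapsto z+\frac{\tau}{\sqrt{\operatorname{Im}\tau}}$. A straight-line map $h:(V,E)\to S_\tau$ in the homotopy class prescribed by this marking is given by a lift $\tilde h:\tilde V\to\mathbb C$ with $$\tilde h\circ\gamma_1=\tilde h+\frac{1}{\sqrt{\operatorname{Im}\tau}},\qquad \tilde h\circ\gamma_2=\tilde h+\frac{\tau}{\sqrt{\operatorname{Im}\tau}},$$ and its Dirichlet energy is $E_c(h)=\frac12\sum_{ij\in E}c_{ij}|\tilde h_j-\tilde h_i|^2$. For each $\tau$, among the maps to $S_\tau$ in the homotopy class there is a minimizer $h_\tau$ of $E_c$, unique up to translation.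 It has a conjugate map, that is, a map $\tilde h^*:\tilde F\to\mathbb C$ such that for every oriented edge $ij$ of the universal cover $$\tilde h^*_{\mathrm{left}(ij)}-\tilde h^*_{\mathrm{right}(ij)}=\sqrt{-1}\,c_{ij}\,(\tilde h_j-\tilde h_i),$$ where $\tilde h$ is the lift of $h_\tau$. For $k>0$, one says that $\tilde h^*$ projects to the scaled torus $kS_\tau$ if $\tilde h^*\circ\gamma_1=\tilde h^*+\frac{k}{\sqrt{\operatorname{Im}\tau}}$ and $\tilde h^*\circ\gamma_2=\tilde h^*+\frac{k\tau}{\sqrt{\operatorname{Im}\tau}}$. Theorem. There exist a unique $\tau_c\in\mathbb H$ and a unique $k_c>0$ such that the following two properties hold. 1. $(\tau_c,h_{\tau_c})$ is the unique minimizer (up to translation of $h_{\tau_c}$) of $(\tau,h)\mapsto E_c(h)$ over all $\tau\in\mathbb H$ and all maps $h$ to $S_\tau$ in the homotopy class, and the minimum value is $k_c$. 2. For every $\tau\in\mathbb H$ and $k>0$, the conjugate map of $h_\tau$ projects to $kS_\tau$ if and only if $\tau=\tau_c$ and $k=k_c$. -/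

import Mathlib

noncomputable section

/-- A combinatorial map: the cell decomposition of a closed oriented surface with set of darts
(oriented edges) `D`. The involution `rev` reverses an oriented edge, and `rot` sends a dart to the
next dart with the same source vertex, in counterclockwise order. -/
structure CellMap (D : Type*) where
  rev : Equiv.Perm D
  rot : Equiv.Perm D
  rev_rev : ∀ d, rev (rev d) = d
  rev_ne : ∀ d, rev d ≠ d

namespace CellMap

variable {D : Type*} (G : CellMap D)

/-- The next dart on the boundary of the face to the left of a dart, that face being kept on the
left. -/
def next : Equiv.Perm D := G.rev.trans G.rot.symm

/-- Vertices: the cycles of `rot`. -/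
def Vertex : Type _ := Quotient (Equiv.Perm.SameCycle.setoid G.rot)

/-- (Unoriented) edges: the cycles of `rev`. -/
def Edge : Type _ := Quotient (Equiv.Perm.SameCycle.setoid G.rev)

/-- Faces: the cycles of `next`; the cycle of `d` is the face to the left of `d`. -/
def Face : Type _ := Quotient (Equiv.Perm.SameCycle.setoid G.next)

/-- The source vertex of a dart. -/
def src (d : D) : G.Vertex := Quotient.mk _ d

/-- The target vertex of a dart. -/
def tgt (d : D) : G.Vertex := G.src (G.rev d)

instance [Finite D] : Finite G.Vertex := inferInstanceAs (Finite (Quotient _))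
instance [Finite D] : Finite G.Edge := inferInstanceAs (Finite (Quotient _))
instance [Finite D] : Finite G.Face := inferInstanceAs (Finite (Quotient _))
instance [Finite D] : Fintype G.Edge := Fintype.ofFinite _
instance [Finite D] : Fintype G.Face := Fintype.ofFinite _

theorem src_next (d : D) : G.src (G.next d) = G.tgt d := by
  refine Quotient.sound ⟨1, ?_⟩
  simp [next]

/-- `l` is the list of darts along an edge path from the vertex `v` to the vertex `w`. -/
def IsWalk : G.Vertex → List D → G.Vertex → Prop
  | v, [], w => v = w
  | v, d :: l, w => G.src d = v ∧ IsWalk (G.tgt d) l w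

variable {G} in
theorem IsWalk.append {u v w : G.Vertex} {l l' : List D} (h : G.IsWalk u l v)
    (h' : G.IsWalk v l' w) : G.IsWalk u (l ++ l') w := by
  induction l generalizing u with
  | nil => exact (show u = v from h) ▸ h'
  | cons d l ih => exact ⟨h.1, ih h.2⟩

/-- Edge paths from `v` to `w`. -/
abbrev Walk (v w : G.Vertex) : Type _ := {l : List D // G.IsWalk v l w}

/-- The boundary of the face to the left of `d`, as a list of darts starting with `d`. -/
def faceBoundary (d : D) : List D :=
  List.iterate G.next d (Function.minimalPeriod G.next d)

/-- The reversed edge path, as a list of darts. -/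
def reversePath (l : List D) : List D := (l.map G.rev).reverse

/-- The elementary homotopies of edge paths: a dart followed by its reverse, or a walk once around
a face, is removed. -/
def Step {v w : G.Vertex} (p q : G.Walk v w) : Prop :=
  ∃ (a b : List D) (d : D), q.1 = a ++ b ∧
    (p.1 = a ++ [d, G.rev d] ++ b ∨ p.1 = a ++ G.faceBoundary d ++ b)

/-- Homotopy classes, with fixed end points, of edge paths from `v` to `w`. -/
def PathClass (v w : G.Vertex) : Type _ := Quot (G.Step (v := v) (w := w))

/-- The vertices of the universal cover: homotopy classes of edge paths issuing from `o`. -/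
abbrev CoverVertex (o : G.Vertex) : Type _ := Σ v : G.Vertex, G.PathClass o v

variable {G} {o : G.Vertex}

/-- The deck transformation of a loop at `o`, on the vertices of the universal cover. -/
def Walk.onVertex (γ : G.Walk o o) (x : G.CoverVertex o) : G.CoverVertex o :=
  ⟨x.1, Quot.map (fun p => ⟨γ.1 ++ p.1, γ.2.append p.2⟩) (by
    rintro p q ⟨a, b, d, hq, hp⟩
    refine ⟨γ.1 ++ a, b, d, by simp [hq], ?_⟩
    rcases hp with hp | hp
    · exact Or.inl (by simp [hp])
    · exact Or.inr (by simp [hp])) x.2⟩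

/-- The end point of the path obtained by following the dart `d` after the path `x`. -/
def CoverVertex.extend (x : G.CoverVertex o) (d : D) (h : G.src d = x.1) : G.CoverVertex o :=
  ⟨G.tgt d, Quot.map (fun p => ⟨p.1 ++ [d], p.2.append ⟨h, rfl⟩⟩) (by
    rintro p q ⟨a, b, d', hq, hp⟩
    refine ⟨a, b ++ [d], d', by simp [hq], ?_⟩
    rcases hp with hp | hp
    · exact Or.inl (by simp [hp])
    · exact Or.inr (by simp [hp])) x.2⟩

theorem Walk.onVertex_extend (γ : G.Walk o o) (x : G.CoverVertex o) (d : D)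
    (h : G.src d = x.1) :
    (γ.onVertex x).extend d h = γ.onVertex (x.extend d h) := by
  obtain ⟨v, p⟩ := x
  induction p using Quot.ind
  simp [Walk.onVertex, CoverVertex.extend, Quot.map]

/-- The loops `γ₁`, `γ₂` generate the fundamental group: every loop at `o` is homotopic to a
product of copies of these two loops and of their inverses. -/
def Generate (γ₁ γ₂ : G.Walk o o) : Prop :=
  ∀ γ : G.Walk o o, ∃ (w : List (List D)) (hw : G.IsWalk o w.flatten o),
    (∀ u ∈ w, u = γ₁.1 ∨ u = γ₂.1 ∨ u = G.reversePath γ₁.1 ∨ u = G.reversePath γ₂.1) ∧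
    (Quot.mk _ γ : G.PathClass o o) = Quot.mk _ ⟨w.flatten, hw⟩

variable (G o)

/-- The darts (oriented edges) of the universal cover: the lifts of darts, each given with its
source. -/
structure CoverDart where
  src : G.CoverVertex o
  dart : D
  src_eq : G.src dart = src.1

variable {G o}

namespace CoverDart

/-- The target of a dart of the universal cover. -/
def tgt (e : G.CoverDart o) : G.CoverVertex o :=
  CoverVertex.extend e.src e.dart e.src_eq

/-- The reversed dart, in the universal cover. -/
def rev (e : G.CoverDart o) : G.CoverDart o := ⟨e.tgt, G.rev e.dart, rfl⟩

/-- The next dart along the face to the left, in the universal cover. -/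
def next (e : G.CoverDart o) : G.CoverDart o := ⟨e.tgt, G.next e.dart, G.src_next e.dart⟩

end CoverDart

variable (G o)

/-- The faces of the universal cover. -/
def CoverFace : Type _ := Quot fun e e' : G.CoverDart o => e' = e.next

variable {G o}

/-- The face to the left of a dart of the universal cover. -/
def CoverDart.left (e : G.CoverDart o) : G.CoverFace o := Quot.mk _ e

/-- The face to the right of a dart of the universal cover. -/
def CoverDart.right (e : G.CoverDart o) : G.CoverFace o := e.rev.left

/-- The deck transformation of a loop at `o`, on the darts of the universal cover. -/
def Walk.onDart (γ : G.Walk o o) (e : G.CoverDart o) : G.CoverDart o :=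
  ⟨γ.onVertex e.src, e.dart, e.src_eq⟩

theorem Walk.onDart_next (γ : G.Walk o o) (e : G.CoverDart o) :
    (γ.onDart e).next = γ.onDart e.next := by
  unfold CoverDart.next
  congr 1
  exact Walk.onVertex_extend γ e.src e.dart e.src_eq

/-- The deck transformation of a loop at `o`, on the faces of the universal cover. -/
def Walk.onFace (γ : G.Walk o o) : G.CoverFace o → G.CoverFace o :=
  Quot.map γ.onDart fun e e' h => by rw [h, γ.onDart_next]

end CellMap

/-- A cell decomposition of the torus: a finite connected combinatorial map with Euler
characteristic `0`. -/
structure TorusDecomposition (D : Type*) [Finite D] extends CellMap D where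
  connected : ∀ v w : toCellMap.Vertex, ∃ l, toCellMap.IsWalk v l w
  euler : (Nat.card toCellMap.Vertex : ℤ) - Nat.card toCellMap.Edge + Nat.card toCellMap.Face = 0

namespace TorusDecomposition

variable {D : Type*} [Finite D] (G : TorusDecomposition D) (o : G.Vertex)

theorem exists_lift (d : D) : ∃ e : G.CoverDart o, e.dart = d := by
  obtain ⟨l, hl⟩ := G.connected o (G.src d)
  exact ⟨⟨⟨G.src d, Quot.mk _ ⟨l, hl⟩⟩, d, rfl⟩, rfl⟩

/-- A lift of a dart to the universal cover. -/
def lift (d : D) : G.CoverDart o := (G.exists_lift o d).choose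

/-- The signed area, by the shoelace formula, of the polygon that is the image of the face to the
left of `e` under a map from the vertices of the universal cover to the plane. -/
def faceArea {o : G.Vertex} (h : G.CoverVertex o → ℂ) (e : G.CoverDart o) : ℝ :=
  (1 / 2) * ∑ i ∈ Finset.range (Function.minimalPeriod G.next e.dart),
    (star (h (CellMap.CoverDart.next^[i] e).src) * h (CellMap.CoverDart.next^[i] e).tgt).im

/-- The total signed area of the faces of the torus under an equivariant map to the plane. -/
def signedArea {o : G.Vertex} (h : G.CoverVertex o → ℂ) : ℝ :=
  ∑ F : G.Face, G.faceArea h (G.lift o (Quotient.out F))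

variable {G o}

/-- `h` is the lift of a map from the graph to the torus `ℂ / (ℤ a + ℤ b)`, the loops `γ₁`, `γ₂`
acting by the translations `a`, `b`. -/
def HasPeriods (γ₁ γ₂ : G.Walk o o) (h : G.CoverVertex o → ℂ) (a b : ℂ) : Prop :=
  ∀ x, h (γ₁.onVertex x) = h x + a ∧ h (γ₂.onVertex x) = h x + b

variable (G)

/-- A marking of the torus: two loops that generate the fundamental group and are positively
oriented, that is, the maps to the square torus `ℂ / (ℤ + ℤ i)` that send them to the standard
generators preserve orientation. -/
structure Marking where
  base : G.Vertex
  γ₁ : G.Walk base base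
  γ₂ : G.Walk base base
  generate : CellMap.Generate γ₁ γ₂
  positive : ∃ h, HasPeriods γ₁ γ₂ h 1 Complex.I ∧ 0 < G.signedArea h

variable {G}

/-- The Dirichlet energy `½ ∑ c_ij |h_j - h_i|²`. -/
def energy (c : G.Edge → ℝ) {o : G.Vertex} (h : G.CoverVertex o → ℂ) : ℝ :=
  (1 / 2) * ∑ e : G.Edge, c e *
    ‖h (G.lift o (Quotient.out e)).tgt - h (G.lift o (Quotient.out e)).src‖ ^ 2

/-- `g`, on the faces of the universal cover, is a conjugate map of `h`. -/
def IsConjugate (c : G.Edge → ℝ) {o : G.Vertex} (h : G.CoverVertex o → ℂ)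
    (g : G.CoverFace o → ℂ) : Prop :=
  ∀ e : G.CoverDart o, g e.left - g e.right =
    Complex.I * (c (Quotient.mk _ e.dart) : ℂ) * (h e.tgt - h e.src)

namespace Marking

variable (M : G.Marking)

/-- `h` is (the lift to the universal cover of) a straight-line map from the graph to the unit-area
Euclidean torus `S_τ`, in the homotopy class prescribed by the marking. -/
def IsMapTo (τ : UpperHalfPlane) (h : G.CoverVertex M.base → ℂ) : Prop :=
  HasPeriods M.γ₁ M.γ₂ h (1 / (√τ.im : ℝ)) (τ / (√τ.im : ℝ))

/-- `h` is the harmonic map `h_τ`: it minimizes the energy among the maps to the fixed torus `S_τ`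
in the homotopy class. -/
def IsHarmonicMap (c : G.Edge → ℝ) (τ : UpperHalfPlane) (h : G.CoverVertex M.base → ℂ) : Prop :=
  M.IsMapTo τ h ∧ ∀ h', M.IsMapTo τ h' → energy c h ≤ energy c h'

/-- `(τ, h)` minimizes the energy among all unit-area Euclidean tori and all maps in the homotopy
class. -/
def IsMinimizer (c : G.Edge → ℝ) (τ : UpperHalfPlane) (h : G.CoverVertex M.base → ℂ) : Prop :=
  M.IsMapTo τ h ∧ ∀ τ' h', M.IsMapTo τ' h' → energy c h ≤ energy c h'

/-- `g`, on the faces of the universal cover, projects to the marked torus `k S_τ`. -/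
def ProjectsTo (g : G.CoverFace M.base → ℂ) (k : ℝ) (τ : UpperHalfPlane) : Prop :=
  ∀ F, g (M.γ₁.onFace F) = g F + k / (√τ.im : ℝ) ∧
    g (M.γ₂.onFace F) = g F + k * τ / (√τ.im : ℝ)

end Marking

end TorusDecomposition

end

/-! A map with prescribed periods minimizes the energy exactly when its weighted increments `flow c
h` have no flux out of any vertex (are coclosed). Such a map exists by solving a Poisson equation on
the graph (`exists_laplacian_eq`), and any other map with these periods exceeds its energy by the
energy of a function on the vertices of the surface, so it is unique up to translation
(`energy_le_of_flow`). By linearity h_τ = (X + τY)/√Im τ up to translation, with X, Y real harmonic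
of periods (1,0) and (0,1).

If a, b, e are the entries of the Gram matrix of dX, dY, the energy of h_τ is (a + 2b Re τ +
e|τ|²)/(2 Im τ) (`exists_gram`). Completing squares, this is K = √(ae − b²) plus a nonnegative term
that vanishes only at τ_c = (−b + iK)/e (`add_div_eq_sqrt_add`).

The conjugate exists by a dimension count. Coclosed forms have dimension at most |E| − |V| + 1,
which is |F| + 1 since the Euler characteristic is 0. Increments of functions on the faces of the
cover that the deck group translates fill |F| + 2 − 1 dimensions, hence everything. Riemann's
bilinear relation reads the periods of the conjugate off its pairings with dX and dY: they are −i(b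
+ τe)/√Im τ and i(a + τb)/√Im τ. Equating them with k/√Im τ and kτ/√Im τ gives the equations of the
minimum, together with k = K (`conjugate_periods_iff`).

The bilinear relation carries the topology. The pairing depends only on the periods, up to a factor,
the signed area A of the torus under a map with the standard periods. Here A is a positive integer,
and 1/A is an integer too, being a period of the function dual to the unit current along γ₁; so A =
1 (`Marking.areaForm_eq_one`). -/

noncomputable section

/-! ### Edge paths, homotopy and deck transformations. -/

namespace CellMap

variable {D : Type*} {G : CellMap D} {o : G.Vertex}

theorem IsWalk.reversePath {v w : G.Vertex} {l : List D} (h : G.IsWalk v l w) :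
    G.IsWalk w (G.reversePath l) v := by
  induction l generalizing v with
  | nil => exact Eq.symm h
  | cons d l ih =>
    have h1 := ih h.2
    have : G.reversePath (d :: l) = G.reversePath l ++ [G.rev d] := by
      simp [CellMap.reversePath]
    rw [this]
    refine h1.append ⟨rfl, ?_⟩
    change G.src (G.rev (G.rev d)) = v
    rw [G.rev_rev]
    exact h.1

theorem reversePath_reversePath (l : List D) : G.reversePath (G.reversePath l) = l := by
  have : G.rev ∘ G.rev = id := funext G.rev_rev
  simp [reversePath, this]

/-- The vertex of the universal cover represented by an edge path. -/
def CoverVertex.ofWalk {v : G.Vertex} (l : List D) (h : G.IsWalk o l v) : G.CoverVertex o :=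
  ⟨v, Quot.mk _ ⟨l, h⟩⟩

namespace CoverVertex

theorem exists_ofWalk (x : G.CoverVertex o) : ∃ v l, ∃ h : G.IsWalk o l v, x = ofWalk l h := by
  obtain ⟨v, p⟩ := x
  obtain ⟨⟨l, h⟩, rfl⟩ := Quot.exists_rep p
  exact ⟨v, l, h, rfl⟩

theorem ofWalk_congr {v w : G.Vertex} {l l' : List D} (h : G.IsWalk o l v) (h' : G.IsWalk o l' w)
    (hl : l = l') (hv : v = w) : ofWalk l h = ofWalk l' h' := by
  subst hl hv; rfl

theorem ofWalk_rev {v : G.Vertex} {a b : List D} {d : D} (h : G.IsWalk o (a ++ [d, G.rev d] ++ b) v)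
    (h' : G.IsWalk o (a ++ b) v) : ofWalk _ h = ofWalk _ h' := by
  have : (Quot.mk _ ⟨_, h⟩ : G.PathClass o v) = Quot.mk _ ⟨_, h'⟩ :=
    Quot.sound ⟨a, b, d, rfl, Or.inl rfl⟩
  simp only [ofWalk, this]

theorem ofWalk_faceBoundary {v : G.Vertex} {a b : List D} {d : D}
    (h : G.IsWalk o (a ++ G.faceBoundary d ++ b) v)
    (h' : G.IsWalk o (a ++ b) v) : ofWalk _ h = ofWalk _ h' := by
  have : (Quot.mk _ ⟨_, h⟩ : G.PathClass o v) = Quot.mk _ ⟨_, h'⟩ :=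
    Quot.sound ⟨a, b, d, rfl, Or.inr rfl⟩
  simp only [ofWalk, this]

/-- The word cancels from the inside: the first dart of `l` joins the prefix and its reverse joins
the suffix, the rest cancels by induction, and one elementary homotopy removes the remaining pair.
-/
theorem ofWalk_reversePath {u v w : G.Vertex} {a l b : List D} (ha : G.IsWalk o a u)
    (hl : G.IsWalk u l v) (hb : G.IsWalk u b w) :
    ofWalk _ (((ha.append hl).append hl.reversePath).append hb) = ofWalk _ (ha.append hb) := by
  induction l generalizing u a b with
  | nil => exact ofWalk_congr _ _ (by simp [reversePath]) rfl
  | cons d l ih =>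
    obtain ⟨hs, hl⟩ := hl
    have hd : G.IsWalk u [d] (G.tgt d) := ⟨hs, rfl⟩
    have hb' : G.IsWalk (G.tgt d) (G.rev d :: b) w :=
      ⟨rfl, by change G.IsWalk (G.src (G.rev (G.rev d))) b w; rw [G.rev_rev, hs]; exact hb⟩
    have h1 := ih (ha.append hd) hl hb'
    have h2 : G.IsWalk o (a ++ [d, G.rev d] ++ b) w := by
      have hdd : G.IsWalk u [d, G.rev d] u :=
        ⟨hs, rfl, (congrArg G.src (G.rev_rev d)).trans hs⟩
      exact (ha.append hdd).append hb
    refine Eq.trans ?_ ((h1.trans ?_).trans (ofWalk_rev h2 (ha.append hb)))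
    · exact ofWalk_congr _ _ (by simp [reversePath]) rfl
    · exact ofWalk_congr _ _ (by simp) rfl

end CoverVertex

open CoverVertex

theorem Walk.onVertex_congr {γ γ' : G.Walk o o}
    (h : (Quot.mk _ γ : G.PathClass o o) = Quot.mk _ γ') (x : G.CoverVertex o) :
    γ.onVertex x = γ'.onVertex x := by
  obtain ⟨v, l, hl, rfl⟩ := exists_ofWalk x
  have := congrArg (fun q : G.PathClass o o => (⟨_, Quot.map
    (fun p : G.Walk o o => (⟨p.1 ++ l, p.2.append hl⟩ : G.Walk o _)) (by
      rintro p q ⟨a, b, d, hq, hp⟩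
      refine ⟨a, b ++ l, d, by simp [hq], ?_⟩
      rcases hp with hp | hp
      · exact Or.inl (by simp [hp])
      · exact Or.inr (by simp [hp])) q⟩ : G.CoverVertex o)) h
  exact this

theorem Walk.onVertex_append (γ γ' : G.Walk o o) (x : G.CoverVertex o) :
    Walk.onVertex ⟨γ.1 ++ γ'.1, γ.2.append γ'.2⟩ x = γ.onVertex (γ'.onVertex x) := by
  obtain ⟨v, l, hl, rfl⟩ := exists_ofWalk x
  exact ofWalk_congr _ _ (List.append_assoc _ _ _) rfl

theorem Walk.onVertex_nil (x : G.CoverVertex o) :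
    Walk.onVertex (⟨[], rfl⟩ : G.Walk o o) x = x := by
  obtain ⟨v, l, hl, rfl⟩ := exists_ofWalk x
  rfl

theorem Walk.onVertex_reversePath (γ : G.Walk o o) (x : G.CoverVertex o) :
    γ.onVertex (Walk.onVertex ⟨G.reversePath γ.1, γ.2.reversePath⟩ x) = x := by
  obtain ⟨v, l, hl, rfl⟩ := exists_ofWalk x
  refine Eq.trans ?_ (Eq.trans (ofWalk_reversePath (o := o) (a := []) rfl γ.2 hl) ?_)
  · exact ofWalk_congr _ _ (by simp) rfl
  · exact ofWalk_congr _ _ (by simp) rfl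

/-- Deck transformations act transitively on fibres: follow the path of `y`, then that of `x`
backwards. -/
theorem exists_onVertex_eq {x y : G.CoverVertex o} (h : x.1 = y.1) :
    ∃ γ : G.Walk o o, γ.onVertex x = y := by
  obtain ⟨v, l, hl, rfl⟩ := exists_ofWalk x
  obtain ⟨w, l', hl', rfl⟩ := exists_ofWalk y
  obtain rfl : v = w := h
  refine ⟨⟨l' ++ G.reversePath l, hl'.append hl.reversePath⟩, ?_⟩
  have := ofWalk_reversePath (b := []) hl' hl.reversePath rfl
  refine Eq.trans ?_ (this.trans ?_)
  · exact ofWalk_congr _ _ (by simp [reversePath_reversePath]) rfl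
  · exact ofWalk_congr _ _ (by simp) rfl

theorem CoverDart.ext' {e e' : G.CoverDart o} (h : e.src = e'.src) (h' : e.dart = e'.dart) :
    e = e' := by
  cases e; cases e'; cases h; cases h'; rfl

theorem exists_onDart_eq {e e' : G.CoverDart o} (h : e.dart = e'.dart) :
    ∃ γ : G.Walk o o, γ.onDart e = e' := by
  obtain ⟨γ, hγ⟩ := exists_onVertex_eq (x := e.src) (y := e'.src) (by
    rw [← e.src_eq, ← e'.src_eq, h])
  exact ⟨γ, CoverDart.ext' hγ h⟩

/-- A function whose increments under two generating deck transformations lie in a subgroup has all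
its increments under deck transformations in that subgroup. -/
theorem Generate.sub_mem {γ₁ γ₂ : G.Walk o o} (hγ : Generate γ₁ γ₂) {A : Type*} [AddCommGroup A]
    (H : AddSubgroup A) (u : G.CoverDart o → A) (h₁ : ∀ e, u (γ₁.onDart e) - u e ∈ H)
    (h₂ : ∀ e, u (γ₂.onDart e) - u e ∈ H) {e e' : G.CoverDart o} (h : e.dart = e'.dart) :
    u e' - u e ∈ H := by
  obtain ⟨γ, rfl⟩ := exists_onDart_eq h
  clear h
  obtain ⟨w, hw, hmem, hγw⟩ := hγ γ
  have hcongr : γ.onDart e = Walk.onDart ⟨w.flatten, hw⟩ e :=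
    CoverDart.ext' (Walk.onVertex_congr hγw _) rfl
  rw [hcongr]
  clear hcongr hγw γ
  have inv : ∀ γ : G.Walk o o, (∀ e, u (γ.onDart e) - u e ∈ H) →
      ∀ e, u (Walk.onDart ⟨G.reversePath γ.1, γ.2.reversePath⟩ e) - u e ∈ H := by
    intro γ h e
    have h3 := h (Walk.onDart ⟨G.reversePath γ.1, γ.2.reversePath⟩ e)
    have h4 : γ.onDart (Walk.onDart ⟨G.reversePath γ.1, γ.2.reversePath⟩ e) = e :=
      CoverDart.ext' (γ.onVertex_reversePath _) rfl
    rw [h4] at h3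
    simpa using H.neg_mem h3
  induction w generalizing e with
  | nil =>
    have : Walk.onDart (⟨[], rfl⟩ : G.Walk o o) e = e := CoverDart.ext' (Walk.onVertex_nil _) rfl
    have h5 : Walk.onDart ⟨([] : List (List D)).flatten, hw⟩ e = e := this
    rw [h5]; simp
  | cons l w ih =>
    have key : ∃ hl : G.IsWalk o l o, ∀ e, u (Walk.onDart ⟨l, hl⟩ e) - u e ∈ H := by
      rcases hmem l (by simp) with rfl | rfl | rfl | rfl
      · exact ⟨γ₁.2, h₁⟩
      · exact ⟨γ₂.2, h₂⟩
      · exact ⟨_, inv _ h₁⟩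
      · exact ⟨_, inv _ h₂⟩
    obtain ⟨hl, hk⟩ := key
    have hw' : G.IsWalk o w.flatten o := by
      have hloop : ∀ l ∈ w, G.IsWalk o l o := by
        intro l hl
        rcases hmem l (by simp [hl]) with rfl | rfl | rfl | rfl
        exacts [γ₁.2, γ₂.2, γ₁.2.reversePath, γ₂.2.reversePath]
      clear ih hmem hk hw
      induction w with
      | nil => rfl
      | cons a w ih =>
        rw [List.flatten_cons]
        exact (hloop a (by simp)).append (ih fun l hl => hloop l (by simp [hl]))
    have h6 : Walk.onDart ⟨(l :: w).flatten, hw⟩ e =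
        Walk.onDart ⟨l, hl⟩ (Walk.onDart ⟨w.flatten, hw'⟩ e) :=
      CoverDart.ext' (Walk.onVertex_append ⟨l, hl⟩ ⟨w.flatten, hw'⟩ e.src) rfl
    rw [h6]
    have := H.add_mem (hk (Walk.onDart ⟨w.flatten, hw'⟩ e))
      (ih hw' (fun l' hl' => hmem l' (by simp [hl'])) (e := e))
    simpa using this

/-! ### Darts and faces of the universal cover, and its connectedness. -/

namespace CoverDart

theorem tgt_rev (e : G.CoverDart o) : e.rev.tgt = e.src := by
  obtain ⟨x, d, h⟩ := e
  obtain ⟨v, l, hl, rfl⟩ := exists_ofWalk x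
  obtain rfl : G.src d = v := h
  have ht : G.tgt (G.rev d) = G.src d := congrArg G.src (G.rev_rev d)
  have h' : G.IsWalk o (l ++ [d, G.rev d] ++ []) (G.src d) :=
    (hl.append (v := G.src d) (w := G.src d) (l' := [d, G.rev d]) ⟨rfl, rfl, ht⟩).append rfl
  have h'' : G.IsWalk o (l ++ []) (G.src d) := hl.append rfl
  refine Eq.trans ?_ ((ofWalk_rev h' h'').trans ?_)
  · exact ofWalk_congr _ _ (by simp [rev]) ht
  · exact ofWalk_congr _ _ (by simp) rfl

theorem rev_rev (e : G.CoverDart o) : e.rev.rev = e :=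
  ext' e.tgt_rev (G.rev_rev _)

theorem right_rev (e : G.CoverDart o) : e.rev.right = e.left := by
  rw [right, rev_rev]

theorem left_next (e : G.CoverDart o) : e.next.left = e.left :=
  (Quot.sound (r := fun e e' : G.CoverDart o => e' = e.next) rfl).symm

theorem left_iterate_next (e : G.CoverDart o) (n : ℕ) : (next^[n] e).left = e.left := by
  induction n with
  | zero => rfl
  | succ n ih => rw [Function.iterate_succ_apply', left_next, ih]

theorem dart_iterate_next (e : G.CoverDart o) (n : ℕ) : (next^[n] e).dart = G.next^[n] e.dart := by
  induction n with
  | zero => rfl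
  | succ n ih => rw [Function.iterate_succ_apply', Function.iterate_succ_apply', ← ih]; rfl

/-- An explicit representing path is kept, so that after a full period the appended part is
literally `faceBoundary d` and the face homotopy applies. -/
theorem src_iterate_next (n : ℕ) (d : D) {l : List D} (hl : G.IsWalk o l (G.src d)) :
    ∃ h : G.IsWalk o (l ++ List.iterate G.next d n) (G.src (G.next^[n] d)),
      (next^[n] (⟨ofWalk l hl, d, rfl⟩ : G.CoverDart o)).src = ofWalk _ h := by
  induction n generalizing d l with
  | zero => exact ⟨hl.append rfl, ofWalk_congr _ _ (by simp) rfl⟩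
  | succ n ih =>
    have hl' : G.IsWalk o (l ++ [d]) (G.src (G.next d)) := hl.append ⟨rfl, (G.src_next d).symm⟩
    obtain ⟨h, heq⟩ := ih (G.next d) hl'
    have hlist : l ++ List.iterate G.next d (n + 1) = l ++ [d] ++ List.iterate G.next (G.next d) n := by
      simp [List.iterate]
    refine ⟨by rw [hlist]; exact h, ?_⟩
    have hn : (⟨ofWalk l hl, d, rfl⟩ : G.CoverDart o).next = ⟨ofWalk (l ++ [d]) hl', G.next d, rfl⟩ :=
      ext' (ofWalk_congr _ _ rfl (G.src_next d).symm) rfl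
    rw [Function.iterate_succ_apply, hn, heq]
    exact ofWalk_congr _ _ hlist.symm rfl

/-- Walking once around a face of the universal cover. -/
theorem iterate_next_minimalPeriod (e : G.CoverDart o) :
    next^[Function.minimalPeriod G.next e.dart] e = e := by
  obtain ⟨x, d, hd⟩ := e
  obtain ⟨v, l, hl, rfl⟩ := exists_ofWalk x
  obtain rfl : G.src d = v := hd
  have hper : G.next^[Function.minimalPeriod G.next d] d = d :=
    Function.isPeriodicPt_minimalPeriod _ _
  obtain ⟨h, heq⟩ := src_iterate_next (Function.minimalPeriod G.next d) d hl
  refine ext' ?_ ?_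
  · refine heq.trans ?_
    have h1 : G.IsWalk o (l ++ G.faceBoundary d ++ []) (G.src d) := by
      have := h
      rw [hper] at this
      simpa [faceBoundary] using this
    have h2 : G.IsWalk o (l ++ []) (G.src d) := hl.append rfl
    refine Eq.trans ?_ ((ofWalk_faceBoundary h1 h2).trans ?_)
    · exact ofWalk_congr _ _ (by simp [faceBoundary]) (by rw [hper])
    · exact ofWalk_congr _ _ (by simp) rfl
  · exact (dart_iterate_next _ _).trans hper

/-- The next dart around the source, in the universal cover. -/
def rot (e : G.CoverDart o) : G.CoverDart o :=
  ⟨e.src, G.rot e.dart, Eq.trans (Quotient.sound ⟨-1, by simp⟩) e.src_eq⟩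

theorem right_rot (e : G.CoverDart o) : e.rot.right = e.left := by
  rw [right, ← left_next]
  congr 1
  refine ext' e.rot.tgt_rev ?_
  simp [next, rev, rot, CellMap.next, G.rev_rev]

theorem left_eq_iff [Finite D] {e e' : G.CoverDart o} :
    e.left = e'.left ↔ ∃ n, next^[n] e = e' := by
  constructor
  · intro h
    replace h := Quot.eqvGen_exact h
    induction h with
    | rel x y h => exact ⟨1, h.symm⟩
    | refl x => exact ⟨0, rfl⟩
    | symm x y _ ih =>
      obtain ⟨n, rfl⟩ := ih
      set p := Function.minimalPeriod G.next x.dart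
      have hp : 0 < p := Function.minimalPeriod_pos_of_mem_periodicPts (by
        exact (G.next.injective.mem_periodicPts) x.dart)
      -- Since `next^[p]` fixes `x`, a further `n * (p - 1)` steps complete `n` turns around the
      -- face and undo `next^[n]`.
      refine ⟨n * (p - 1), ?_⟩
      rw [← Function.iterate_add_apply, show n * (p - 1) + n = n * p by
        obtain ⟨q, hq⟩ := Nat.exists_eq_add_of_lt hp
        rw [hq]; simp; ring]
      exact (Function.IsPeriodicPt.const_mul (f := next) (iterate_next_minimalPeriod x) n)
    | trans x y z _ _ ih1 ih2 =>
      obtain ⟨n, rfl⟩ := ih1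
      obtain ⟨m, rfl⟩ := ih2
      exact ⟨m + n, Function.iterate_add_apply _ _ _ _⟩
  · rintro ⟨n, rfl⟩
    exact (left_iterate_next e n).symm

/-- No nontrivial deck transformation fixes a face: darts of one face with the same image differ by
whole turns, which are null-homotopic. This makes `corner` equivariant. -/
theorem eq_of_left_eq [Finite D] {e e' : G.CoverDart o} (h : e.left = e'.left)
    (h' : e.dart = e'.dart) : e = e' := by
  obtain ⟨n, rfl⟩ := left_eq_iff.1 h
  rw [dart_iterate_next] at h'
  have hn : Function.IsPeriodicPt G.next n e.dart := h'.symm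
  obtain ⟨m, rfl⟩ := hn.minimalPeriod_dvd
  exact ((Function.IsPeriodicPt.mul_const (f := next) (iterate_next_minimalPeriod e) m)).symm

end CoverDart

/-- The face of the surface below a face of the universal cover. -/
def CoverFace.proj : G.CoverFace o → G.Face :=
  Quot.lift (fun e => Quotient.mk _ e.dart) (by
    rintro e e' rfl
    exact Quotient.sound ⟨1, rfl⟩)

theorem CoverFace.exists_left_eq (F : G.CoverFace o) : ∃ e : G.CoverDart o, e.left = F :=
  Quot.exists_rep F

theorem CoverFace.exists_dart_eq_out [Finite D] (F : G.CoverFace o) :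
    ∃ e : G.CoverDart o, e.left = F ∧ e.dart = Quotient.out (CoverFace.proj F) := by
  obtain ⟨e, rfl⟩ := F.exists_left_eq
  have h : G.next.SameCycle e.dart (Quotient.out (CoverFace.proj e.left)) :=
    Quotient.exact (Quotient.out_eq (CoverFace.proj e.left)).symm
  obtain ⟨n, hn⟩ := h.exists_nat_pow_eq
  refine ⟨CoverDart.next^[n] e, CoverDart.left_iterate_next e n, ?_⟩
  rw [CoverDart.dart_iterate_next, ← hn, Equiv.Perm.iterate_eq_pow]

/-- A marked vertex on the boundary of each face, chosen in a way that is invariant under the deck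
transformations. -/
def CoverFace.corner [Finite D] (F : G.CoverFace o) : G.CoverVertex o :=
  F.exists_dart_eq_out.choose.src

theorem CoverFace.corner_onFace [Finite D] (γ : G.Walk o o) (F : G.CoverFace o) :
    (γ.onFace F).corner = γ.onVertex F.corner := by
  have h1 := (γ.onFace F).exists_dart_eq_out.choose_spec
  have h2 := F.exists_dart_eq_out.choose_spec
  have h3 : CoverFace.proj (γ.onFace F) = CoverFace.proj F := by
    obtain ⟨e, rfl⟩ := F.exists_left_eq; rfl
  have := CoverDart.eq_of_left_eq (e := (γ.onFace F).exists_dart_eq_out.choose)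
    (e' := γ.onDart F.exists_dart_eq_out.choose)
    (h1.1.trans (congrArg γ.onFace h2.1.symm)) (by
      rw [h1.2, h3]; exact h2.2.symm)
  exact congrArg CoverDart.src this

/-- The cover is connected: increments telescope along a path from the base point. With `H = ⊥` this
shows that functions are constant, with `H = ℤ` that their differences are integers. -/
theorem CoverVertex.sub_mem {A : Type*} [AddCommGroup A] (H : AddSubgroup A)
    (h : G.CoverVertex o → A) (hh : ∀ e : G.CoverDart o, h e.tgt - h e.src ∈ H)
    (x y : G.CoverVertex o) : h y - h x ∈ H := by
  have key : ∀ x, h x - h (ofWalk (v := o) [] rfl) ∈ H := by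
    intro x
    obtain ⟨v, l, hl, rfl⟩ := exists_ofWalk x
    have : ∀ (l : List D) {v w} (a : List D) (ha : G.IsWalk o a v) (hl : G.IsWalk v l w),
        h (ofWalk _ (ha.append hl)) - h (ofWalk a ha) ∈ H := by
      intro l
      induction l with
      | nil =>
        intro v w a ha hl
        have : ofWalk _ (ha.append hl) = ofWalk a ha := ofWalk_congr _ _ (by simp) hl.symm
        rw [this]; simp
      | cons d l ih =>
        intro v w a ha hl
        have h1 := ih (a ++ [d]) (ha.append ⟨hl.1, rfl⟩) hl.2
        have h2 := hh ⟨ofWalk a ha, d, hl.1⟩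
        have h3 : ofWalk _ (ha.append hl) =
            ofWalk _ (IsWalk.append (ha.append (l' := [d]) ⟨hl.1, rfl⟩) hl.2) :=
          ofWalk_congr _ _ (by simp) rfl
        have := H.add_mem h1 h2
        rw [h3]
        change _ - h (ofWalk (a ++ [d]) (ha.append ⟨hl.1, rfl⟩)) +
          (h (ofWalk (a ++ [d]) (ha.append ⟨hl.1, rfl⟩)) - h (ofWalk a ha)) ∈ H at this
        simpa using this
    exact this l [] rfl hl
  have := H.sub_mem (key y) (key x)
  simpa using this

/-- The dual graph is connected. Turning around a vertex links all faces there, and adjacent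
vertices share a face, so the claim reduces to connectedness of the vertices. -/
theorem CoverFace.sub_mem [Finite D] {A : Type*} [AddCommGroup A] (H : AddSubgroup A)
    (g : G.CoverFace o → A) (hg : ∀ e : G.CoverDart o, g e.left - g e.right ∈ H)
    (E F : G.CoverFace o) : g F - g E ∈ H := by
  have hrot : ∀ (n : ℕ) (e : G.CoverDart o), g (CoverDart.rot^[n] e).left - g e.left ∈ H := by
    intro n e
    induction n with
    | zero => simp
    | succ n ih =>
      have := hg (CoverDart.rot^[n + 1] e)
      rw [Function.iterate_succ_apply', CoverDart.right_rot] at this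
      rw [Function.iterate_succ_apply']
      simpa using H.add_mem this ih
  have hsrc : ∀ e e' : G.CoverDart o, e.src = e'.src → g e'.left - g e.left ∈ H := by
    intro e e' h
    have h1 : G.rot.SameCycle e.dart e'.dart :=
      Quotient.exact ((e.src_eq.trans (congrArg Sigma.fst h)).trans e'.src_eq.symm)
    obtain ⟨n, hn⟩ := h1.exists_nat_pow_eq
    have h2 : CoverDart.rot^[n] e = e' := by
      have hs : ∀ n, (CoverDart.rot^[n] e).src = e.src ∧
          (CoverDart.rot^[n] e).dart = (G.rot ^ n) e.dart := by
        intro n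
        induction n with
        | zero => simp
        | succ n ih =>
          rw [Function.iterate_succ_apply', pow_succ', Equiv.Perm.mul_apply, ← ih.2]
          exact ⟨ih.1, rfl⟩
      exact CoverDart.ext' ((hs n).1.trans h) ((hs n).2.trans hn)
    rw [← h2]
    exact hrot n e
  have hout : ∀ x : G.CoverVertex o, G.src (Quotient.out x.1) = x.1 := fun x => Quotient.out_eq x.1
  -- One face is chosen at each vertex. Modulo `H` the choice is irrelevant by `hsrc`, and `e`,
  -- `e.next` have the same left face, so the increments of `ψ` lie in `H`.
  let ψ : G.CoverVertex o → A := fun x => g (CoverDart.left ⟨x, Quotient.out x.1, hout x⟩)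
  have hψ : ∀ e : G.CoverDart o, g e.left - ψ e.src ∈ H := fun e => hsrc _ _ rfl
  obtain ⟨e, rfl⟩ := E.exists_left_eq
  obtain ⟨f, rfl⟩ := F.exists_left_eq
  have h3 := CoverVertex.sub_mem H ψ (fun e => by
    have := H.sub_mem (hψ e) (hψ e.next)
    rw [CoverDart.left_next] at this
    simpa [CoverDart.next] using this) e.src f.src
  have := H.add_mem h3 (H.sub_mem (hψ f) (hψ e))
  change g f.left - g e.left ∈ H
  convert this using 1
  abel

end CellMap

/-! ### Sums over cycles; discrete forms, divergence and Green's formula. -/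

open scoped Classical in
theorem Equiv.Perm.sum_eq_sum_cycles {α A : Type*} [Fintype α] [AddCommMonoid A]
    (σ : Equiv.Perm α) [Fintype (Quotient (Equiv.Perm.SameCycle.setoid σ))] (f : α → A) :
    ∑ a, f a = ∑ q : Quotient (Equiv.Perm.SameCycle.setoid σ),
      ∑ i ∈ Finset.range (Function.minimalPeriod σ q.out), f (σ^[i] q.out) := by
  rw [← Finset.sum_fiberwise Finset.univ (fun a => Quotient.mk (Equiv.Perm.SameCycle.setoid σ) a) f]
  refine Finset.sum_congr rfl fun q _ => (Finset.sum_nbij (fun i => σ^[i] q.out) ?_ ?_ ?_ ?_).symm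
  · intro i _
    simp only [Finset.mem_filter_univ]
    conv_rhs => rw [← Quotient.out_eq q]
    exact Quotient.sound ⟨-i, by simp [Equiv.Perm.iterate_eq_pow]⟩
  · intro i hi j hj hij
    exact Function.iterate_injOn_Iio_minimalPeriod (by simpa using hi) (by simpa using hj) hij
  · intro a ha
    simp only [Finset.coe_filter, Finset.mem_univ, true_and, Set.mem_ofPred_eq] at ha
    have h : σ.SameCycle q.out a := Quotient.exact ((Quotient.out_eq q).trans ha.symm)
    obtain ⟨n, hn⟩ := h.exists_nat_pow_eq
    refine ⟨n % Function.minimalPeriod σ q.out, ?_, ?_⟩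
    · simp only [Finset.coe_range, Set.mem_Iio]
      exact Nat.mod_lt _ (Function.minimalPeriod_pos_of_mem_periodicPts
        (σ.injective.mem_periodicPts _))
    · change σ^[_] _ = a
      rw [Function.iterate_mod_minimalPeriod_eq, Equiv.Perm.iterate_eq_pow, hn]
  · intro i _; rfl

namespace CellMap

variable {D : Type*} {G : CellMap D} {o : G.Vertex}

instance [Finite D] : Fintype G.Vertex := Fintype.ofFinite _

theorem minimalPeriod_rev (d : D) : Function.minimalPeriod G.rev d = 2 :=
  haveI : Fact (Nat.Prime 2) := ⟨Nat.prime_two⟩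
  Function.minimalPeriod_eq_prime (G.rev_rev d) (G.rev_ne d)

theorem sum_eq_sum_edge [Fintype D] {A : Type*} [AddCommMonoid A] (f : D → A) :
    ∑ d, f d = ∑ e : G.Edge, (f (Quotient.out e) + f (G.rev (Quotient.out e))) := by
  let : Fintype (Quotient (Equiv.Perm.SameCycle.setoid G.rev)) := inferInstanceAs (Fintype G.Edge)
  refine (Equiv.Perm.sum_eq_sum_cycles G.rev f).trans (Finset.sum_congr rfl fun q _ => ?_)
  rw [minimalPeriod_rev, Finset.sum_range_succ, Finset.sum_range_one]
  rfl

theorem sum_eq_sum_face [Fintype D] {A : Type*} [AddCommMonoid A] (f : D → A) :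
    ∑ d, f d = ∑ F : G.Face, ∑ i ∈ Finset.range (Function.minimalPeriod G.next (Quotient.out F)),
      f (G.next^[i] (Quotient.out F)) := by
  let : Fintype (Quotient (Equiv.Perm.SameCycle.setoid G.next)) :=
    inferInstanceAs (Fintype G.Face)
  exact Equiv.Perm.sum_eq_sum_cycles G.next f

theorem sum_rev [Fintype D] {A : Type*} [AddCommMonoid A] (f : D → A) :
    ∑ d, f (G.rev d) = ∑ d, f d := Equiv.sum_comp G.rev f

theorem edge_rev (d : D) : (Quotient.mk _ (G.rev d) : G.Edge) = Quotient.mk _ d :=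
  Quotient.sound ⟨1, by simp [G.rev_rev]⟩

variable (G) in
open scoped Classical in
/-- The flux of a form out of each vertex. -/
def div [Fintype D] : (D → ℂ) →ₗ[ℂ] (G.Vertex → ℂ) where
  toFun α v := ∑ d with G.src d = v, α d
  map_add' α β := by ext v; simp [Finset.sum_add_distrib]
  map_smul' r α := by ext v; simp [Finset.mul_sum]

variable (G) in
/-- The forms: antisymmetric functions on darts. -/
def forms : Submodule ℂ (D → ℂ) where
  carrier := {α | ∀ d, α (G.rev d) = -α d}
  add_mem' {α β} ha hb d := by simp [ha d, hb d]; ring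
  zero_mem' d := by simp
  smul_mem' r α ha d := by simp [ha d]

variable (G) in
/-- The coclosed forms: antisymmetric functions on darts without flux out of any vertex. -/
def coclosed [Fintype D] : Submodule ℂ (D → ℂ) := G.forms ⊓ LinearMap.ker G.div

theorem mem_coclosed [Fintype D] {α : D → ℂ} :
    α ∈ G.coclosed ↔ (∀ d, α (G.rev d) = -α d) ∧ ∀ v, G.div α v = 0 := by
  simp only [coclosed, Submodule.mem_inf, LinearMap.mem_ker, funext_iff, Pi.zero_apply]
  rfl

theorem sum_src_mul [Fintype D] (φ : G.Vertex → ℂ) (α : D → ℂ) :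
    ∑ d, φ (G.src d) * α d = ∑ v, φ v * G.div α v := by
  classical
  rw [← Finset.sum_fiberwise Finset.univ G.src]
  refine Finset.sum_congr rfl fun v _ => ?_
  simp only [div, LinearMap.coe_mk, AddHom.coe_mk, Finset.mul_sum]
  refine Finset.sum_congr (by congr) fun d hd => ?_
  rw [(Finset.mem_filter.1 hd).2]

/-- Green's formula. -/
theorem sum_sub_mul [Fintype D] (φ : G.Vertex → ℂ) {α : D → ℂ} (hα : α ∈ G.forms) :
    ∑ d, (φ (G.tgt d) - φ (G.src d)) * α d = -2 * ∑ v, φ v * G.div α v := by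
  have h : ∑ d, φ (G.tgt d) * α d = -∑ d, φ (G.src d) * α d := by
    rw [← Finset.sum_neg_distrib, ← G.sum_rev]
    refine Finset.sum_congr rfl fun d _ => ?_
    rw [hα d, tgt, G.rev_rev]; ring
  simp only [sub_mul, Finset.sum_sub_distrib]
  rw [h, ← sum_src_mul]; ring

end CellMap

/-! ### Functions with periods and their increments. -/

namespace TorusDecomposition

open CellMap

variable {D : Type*}

section
variable [Finite D] {G : TorusDecomposition D} {o : G.Vertex}

/-- The deck transformations of two loops act on a function on the faces by translations. -/
def HasFacePeriods (γ₁ γ₂ : G.Walk o o) (g : G.CoverFace o → ℂ) (a b : ℂ) : Prop :=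
  ∀ F, g (γ₁.onFace F) = g F + a ∧ g (γ₂.onFace F) = g F + b

variable {γ₁ γ₂ : G.Walk o o}

theorem HasPeriods.add {h k : G.CoverVertex o → ℂ} {a b a' b' : ℂ} (hh : HasPeriods γ₁ γ₂ h a b)
    (hk : HasPeriods γ₁ γ₂ k a' b') :
    HasPeriods γ₁ γ₂ (fun x => h x + k x) (a + a') (b + b') := fun x =>
  ⟨by simp only [(hh x).1, (hk x).1]; ring, by simp only [(hh x).2, (hk x).2]; ring⟩

theorem HasPeriods.const_mul {h : G.CoverVertex o → ℂ} {a b : ℂ} (r : ℂ)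
    (hh : HasPeriods γ₁ γ₂ h a b) : HasPeriods γ₁ γ₂ (fun x => r * h x) (r * a) (r * b) := fun x =>
  ⟨by simp only [(hh x).1]; ring, by simp only [(hh x).2]; ring⟩

theorem HasPeriods.base (φ : G.Vertex → ℂ) : HasPeriods γ₁ γ₂ (fun x => φ x.1) 0 0 := fun x =>
  ⟨by simp [Walk.onVertex], by simp [Walk.onVertex]⟩

theorem HasPeriods.ofReal_re {h : G.CoverVertex o → ℂ} {a b : ℂ} (hh : HasPeriods γ₁ γ₂ h a b) :
    HasPeriods γ₁ γ₂ (fun x => ((h x).re : ℂ)) a.re b.re := fun x =>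
  ⟨by simp only [(hh x).1]; simp, by simp only [(hh x).2]; simp⟩

theorem HasPeriods.ofReal_im {h : G.CoverVertex o → ℂ} {a b : ℂ} (hh : HasPeriods γ₁ γ₂ h a b) :
    HasPeriods γ₁ γ₂ (fun x => ((h x).im : ℂ)) a.im b.im := fun x =>
  ⟨by simp only [(hh x).1]; simp, by simp only [(hh x).2]; simp⟩

theorem HasPeriods.corner {h : G.CoverVertex o → ℂ} {a b : ℂ} (hh : HasPeriods γ₁ γ₂ h a b) :
    HasFacePeriods γ₁ γ₂ (fun F => h F.corner) a b := fun F =>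
  ⟨by simp only [CoverFace.corner_onFace]; exact (hh _).1,
    by simp only [CoverFace.corner_onFace]; exact (hh _).2⟩

theorem HasFacePeriods.add {h k : G.CoverFace o → ℂ} {a b a' b' : ℂ}
    (hh : HasFacePeriods γ₁ γ₂ h a b) (hk : HasFacePeriods γ₁ γ₂ k a' b') :
    HasFacePeriods γ₁ γ₂ (fun x => h x + k x) (a + a') (b + b') := fun x =>
  ⟨by simp only [(hh x).1, (hk x).1]; ring, by simp only [(hh x).2, (hk x).2]; ring⟩

theorem HasFacePeriods.const_mul {h : G.CoverFace o → ℂ} {a b : ℂ} (r : ℂ)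
    (hh : HasFacePeriods γ₁ γ₂ h a b) :
    HasFacePeriods γ₁ γ₂ (fun x => r * h x) (r * a) (r * b) := fun x =>
  ⟨by simp only [(hh x).1]; ring, by simp only [(hh x).2]; ring⟩

theorem HasFacePeriods.base (φ : G.Face → ℂ) : HasFacePeriods γ₁ γ₂ (fun F => φ F.proj) 0 0 := by
  intro F
  obtain ⟨e, rfl⟩ := F.exists_left_eq
  exact ⟨(add_zero _).symm, (add_zero _).symm⟩

theorem lift_dart (d : D) : (G.lift o d).dart = d := (G.exists_lift o d).choose_spec

/-- The increments along darts of a function on the vertices of the universal cover. -/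
def diff (h : G.CoverVertex o → ℂ) (d : D) : ℂ := h (G.lift o d).tgt - h (G.lift o d).src

/-- The increments across darts of a function on the faces of the universal cover. -/
def codiff (g : G.CoverFace o → ℂ) (d : D) : ℂ := g (G.lift o d).left - g (G.lift o d).right

theorem _root_.CellMap.Generate.apply_eq (hγ : Generate γ₁ γ₂) {A : Type*} [AddCommGroup A]
    (u : G.CoverDart o → A) (h₁ : ∀ e, u (γ₁.onDart e) = u e) (h₂ : ∀ e, u (γ₂.onDart e) = u e)
    {e e' : G.CoverDart o} (h : e.dart = e'.dart) : u e = u e' := by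
  have := hγ.sub_mem ⊥ u (fun e => by simp [h₁]) (fun e => by simp [h₂]) h
  exact (sub_eq_zero.1 (by simpa using this)).symm

theorem _root_.CellMap.CoverDart.tgt_onDart (γ : G.Walk o o) (e : G.CoverDart o) :
    (γ.onDart e).tgt = γ.onVertex e.tgt := γ.onVertex_extend e.src e.dart e.src_eq

theorem _root_.CellMap.CoverDart.rev_onDart (γ : G.Walk o o) (e : G.CoverDart o) :
    (γ.onDart e).rev = γ.onDart e.rev := CoverDart.ext' (CoverDart.tgt_onDart γ e) rfl

theorem _root_.CellMap.CoverDart.right_onDart (γ : G.Walk o o) (e : G.CoverDart o) :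
    (γ.onDart e).right = γ.onFace e.right := congrArg CoverDart.left (CoverDart.rev_onDart γ e)

/-- Increments of a function with periods are deck invariant, so the lift chosen in `diff` does not
matter. -/
theorem HasPeriods.sub_eq_diff (hγ : Generate γ₁ γ₂) {h : G.CoverVertex o → ℂ} {a b : ℂ}
    (hh : HasPeriods γ₁ γ₂ h a b) (e : G.CoverDart o) : h e.tgt - h e.src = diff h e.dart := by
  have hs : ∀ (γ : G.Walk o o) (e : G.CoverDart o), (γ.onDart e).src = γ.onVertex e.src :=
    fun _ _ => rfl
  refine hγ.apply_eq (fun e => h e.tgt - h e.src) ?_ ?_ (lift_dart e.dart).symm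
  · intro e
    simp only [CoverDart.tgt_onDart, hs, (hh _).1]; ring
  · intro e
    simp only [CoverDart.tgt_onDart, hs, (hh _).2]; ring

theorem HasFacePeriods.sub_eq_codiff (hγ : Generate γ₁ γ₂) {g : G.CoverFace o → ℂ} {a b : ℂ}
    (hg : HasFacePeriods γ₁ γ₂ g a b) (e : G.CoverDart o) :
    g e.left - g e.right = codiff g e.dart := by
  have hl : ∀ (γ : G.Walk o o) (e : G.CoverDart o), (γ.onDart e).left = γ.onFace e.left :=
    fun _ _ => rfl
  refine hγ.apply_eq (fun e => g e.left - g e.right) ?_ ?_ (lift_dart e.dart).symm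
  · intro e
    simp only [CoverDart.right_onDart, hl, (hg _).1]; ring
  · intro e
    simp only [CoverDart.right_onDart, hl, (hg _).2]; ring

theorem HasPeriods.diff_rev (hγ : Generate γ₁ γ₂) {h : G.CoverVertex o → ℂ} {a b : ℂ}
    (hh : HasPeriods γ₁ γ₂ h a b) (d : D) : diff h (G.rev d) = -diff h d := by
  have h1 := hh.sub_eq_diff hγ (G.lift o d).rev
  have h2 : (G.lift o d).rev.dart = G.rev d := congrArg G.rev (lift_dart d)
  rw [h2, CoverDart.tgt_rev] at h1
  rw [← h1, diff]
  change _ - h (G.lift o d).tgt = _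
  ring

theorem HasFacePeriods.codiff_rev (hγ : Generate γ₁ γ₂) {g : G.CoverFace o → ℂ} {a b : ℂ}
    (hg : HasFacePeriods γ₁ γ₂ g a b) (d : D) : codiff g (G.rev d) = -codiff g d := by
  have h1 := hg.sub_eq_codiff hγ (G.lift o d).rev
  have h2 : (G.lift o d).rev.dart = G.rev d := congrArg G.rev (lift_dart d)
  rw [h2, CoverDart.right_rev] at h1
  rw [← h1, codiff]
  change g (G.lift o d).right - _ = _
  ring

theorem diff_base (φ : G.Vertex → ℂ) (d : D) :
    diff (o := o) (fun x => φ x.1) d = φ (G.tgt d) - φ (G.src d) := by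
  have h1 : (G.lift o d).tgt.1 = G.tgt d := congrArg G.tgt (lift_dart d)
  have h2 : (G.lift o d).src.1 = G.src d := by rw [← (G.lift o d).src_eq, lift_dart]
  rw [diff, h1, h2]

theorem diff_add (h k : G.CoverVertex o → ℂ) (d : D) :
    diff (fun x => h x + k x) d = diff h d + diff k d := by
  simp only [diff]; ring

theorem diff_const_mul (r : ℂ) (h : G.CoverVertex o → ℂ) (d : D) :
    diff (fun x => r * h x) d = r * diff h d := by
  simp only [diff]; ring

end

/-! ### Signed area and the pairing of increments. -/

section
variable [Fintype D] {G : TorusDecomposition D} {o : G.Vertex} {γ₁ γ₂ : G.Walk o o}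

theorem HasFacePeriods.codiff_mem_coclosed (hγ : Generate γ₁ γ₂) {g : G.CoverFace o → ℂ} {a b : ℂ}
    (hg : HasFacePeriods γ₁ γ₂ g a b) : codiff g ∈ G.coclosed := by
  classical
  refine mem_coclosed.2 ⟨hg.codiff_rev hγ, fun v => ?_⟩
  obtain ⟨l, hl⟩ := G.connected o v
  let x : G.CoverVertex o := CoverVertex.ofWalk l hl
  have hsum : G.div (codiff g) v = ∑ d : {d // G.src d = v}, codiff g d :=
    Finset.sum_subtype _ (by simp) _
  let e : {d // G.src d = v} → G.CoverDart o := fun d => ⟨x, d.1, d.2⟩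
  have hrot : ∀ d, G.src (G.rot d) = G.src d := fun d => Quotient.sound ⟨-1, by simp⟩
  -- Rotation permutes the darts at `v` and turns the left face of each into the right face of the
  -- next, so the flux cancels cyclically.
  let σ : Equiv.Perm {d // G.src d = v} := G.rot.subtypePerm fun d => by rw [hrot d]
  have hcod : ∀ d : {d // G.src d = v}, codiff g d = g (e d).left - g (e d).right :=
    fun d => (hg.sub_eq_codiff hγ (e d)).symm
  have hr : ∀ d, (e (σ d)).right = (e d).left := fun d => (e d).right_rot
  rw [hsum]
  simp only [hcod, Finset.sum_sub_distrib]
  rw [← Equiv.sum_comp σ fun d => g (e d).right]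
  simp only [hr, sub_self]

/-- The polarization of the signed area. -/
def areaForm (x y : G.CoverVertex o → ℂ) : ℂ :=
  ∑ F : G.Face, (1 / 2) * ∑ i ∈ Finset.range (Function.minimalPeriod G.next (Quotient.out F)),
    (x (CoverDart.next^[i] (G.lift o (Quotient.out F))).src *
        y (CoverDart.next^[i] (G.lift o (Quotient.out F))).tgt -
      x (CoverDart.next^[i] (G.lift o (Quotient.out F))).tgt *
        y (CoverDart.next^[i] (G.lift o (Quotient.out F))).src)

theorem areaForm_swap (x y : G.CoverVertex o → ℂ) : areaForm x y = -areaForm y x := by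
  simp only [areaForm, ← Finset.sum_neg_distrib, ← mul_neg]
  refine Finset.sum_congr rfl fun F _ => ?_
  congr 1
  refine Finset.sum_congr rfl fun i _ => by ring

theorem signedArea_eq_areaForm (h : G.CoverVertex o → ℂ) :
    (G.signedArea h : ℂ) = areaForm (fun x => ((h x).re : ℂ)) (fun x => ((h x).im : ℂ)) := by
  simp only [signedArea, faceArea, areaForm, lift_dart]
  push_cast
  refine Finset.sum_congr rfl fun F _ => ?_
  congr 1
  refine Finset.sum_congr rfl fun i _ => ?_
  norm_cast
  simp [Complex.mul_im]
  ring

/-- The pairing of the increments of `y` with those of a function `f` on the faces depends on `f`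
only through its periods. -/
theorem sum_diff_mul_codiff (hγ : Generate γ₁ γ₂) {x y : G.CoverVertex o → ℂ}
    {f : G.CoverFace o → ℂ} {a b p q : ℂ} (hx : HasPeriods γ₁ γ₂ x a b)
    (hf : HasFacePeriods γ₁ γ₂ f a b) (hy : HasPeriods γ₁ γ₂ y p q) :
    ∑ d, diff y d * codiff f d = -2 * areaForm x y := by
  -- Subtracting the mean of `x` over the end points makes `u` deck invariant, as `x` and `f` have
  -- the same periods. The mean is unchanged by reversal, so it drops out of `u e + u e.rev`.
  let u : G.CoverDart o → ℂ := fun e => (y e.tgt - y e.src) * (f e.left - (x e.src + x e.tgt) / 2)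
  have hl : ∀ (γ : G.Walk o o) (e : G.CoverDart o), (γ.onDart e).left = γ.onFace e.left :=
    fun _ _ => rfl
  have hs : ∀ (γ : G.Walk o o) (e : G.CoverDart o), (γ.onDart e).src = γ.onVertex e.src :=
    fun _ _ => rfl
  have hu : ∀ e, u e = u (G.lift o e.dart) := by
    intro e
    refine hγ.apply_eq u ?_ ?_ (lift_dart e.dart).symm
    · intro e
      simp only [u, CoverDart.tgt_onDart, hl, hs, (hx _).1, (hy _).1, (hf _).1]; ring
    · intro e
      simp only [u, CoverDart.tgt_onDart, hl, hs, (hx _).2, (hy _).2, (hf _).2]; ring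
  have h1 : ∀ d, diff y d * codiff f d = u (G.lift o d) + u (G.lift o (G.rev d)) := by
    intro d
    have h2 : (G.lift o d).rev.dart = G.rev d := congrArg G.rev (lift_dart d)
    rw [← h2, ← hu]
    simp only [u, CoverDart.tgt_rev, diff, codiff]
    change _ = _ + (_ - y (G.lift o d).tgt) * (f (G.lift o d).right - (x (G.lift o d).tgt + _) / 2)
    ring
  simp only [h1, Finset.sum_add_distrib]
  rw [G.sum_rev fun d => u (G.lift o d), ← two_mul, G.sum_eq_sum_face, areaForm, Finset.mul_sum,
    Finset.mul_sum]
  refine Finset.sum_congr rfl fun F _ => ?_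
  set e := G.lift o (Quotient.out F)
  have he : e.dart = Quotient.out F := lift_dart _
  have hn : CoverDart.next^[Function.minimalPeriod G.next (Quotient.out F)] e = e := by
    have := e.iterate_next_minimalPeriod
    rwa [he] at this
  have hiter : ∀ i, u (G.lift o (G.next^[i] (Quotient.out F))) = u (CoverDart.next^[i] e) := by
    intro i
    rw [hu (CoverDart.next^[i] e), CoverDart.dart_iterate_next, he]
  simp only [hiter]
  have htgt : ∀ i, (CoverDart.next^[i] e).tgt = (CoverDart.next^[i + 1] e).src := by
    intro i; rw [Function.iterate_succ_apply']; rfl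
  -- Around one face `f` is constant; `u` is a telescoping difference minus the shoelace term.
  have htel := Finset.sum_range_sub (fun i => f e.left * y (CoverDart.next^[i] e).src -
    x (CoverDart.next^[i] e).src * y (CoverDart.next^[i] e).src / 2)
    (Function.minimalPeriod G.next (Quotient.out F))
  rw [hn, Function.iterate_zero, id, sub_self] at htel
  have hu' : ∀ i, u (CoverDart.next^[i] e) = f e.left * y (CoverDart.next^[i + 1] e).src -
      x (CoverDart.next^[i + 1] e).src * y (CoverDart.next^[i + 1] e).src / 2 -
      (f e.left * y (CoverDart.next^[i] e).src -
        x (CoverDart.next^[i] e).src * y (CoverDart.next^[i] e).src / 2) -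
      (x (CoverDart.next^[i] e).src * y (CoverDart.next^[i] e).tgt -
        x (CoverDart.next^[i] e).tgt * y (CoverDart.next^[i] e).src) / 2 := by
    intro i
    simp only [u, htgt, CoverDart.left_iterate_next]
    ring
  simp only [hu']
  rw [Finset.sum_sub_distrib, htel, ← Finset.sum_div]
  ring

end

end TorusDecomposition

/-! ### The weighted Laplacian and currents along paths. -/

namespace CellMap

variable {D : Type*} {G : CellMap D}

theorem mul_mem_forms (c : G.Edge → ℝ) {α : D → ℂ} (hα : α ∈ G.forms) :
    (fun d => (c (Quotient.mk _ d) : ℂ) * α d) ∈ G.forms := fun d => by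
  simp only [edge_rev, hα d]; ring

theorem grad_mem_forms (φ : G.Vertex → ℂ) :
    (fun d => φ (G.tgt d) - φ (G.src d)) ∈ G.forms := fun d => by
  simp only [tgt, G.rev_rev]; ring

open scoped Classical in
/-- The flow of a unit current along an edge path. -/
def current (G : CellMap D) : List D → D → ℂ
  | [] => 0
  | d :: l => Pi.single d 1 - Pi.single (G.rev d) 1 + current G l

theorem current_mem_forms (l : List D) : G.current l ∈ G.forms := by
  classical
  induction l with
  | nil => exact G.forms.zero_mem
  | cons d l ih =>
    refine G.forms.add_mem (fun d' => ?_) ih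
    have h1 : G.rev d' = d ↔ d' = G.rev d :=
      ⟨fun h => by rw [← h, G.rev_rev], fun h => by rw [h, G.rev_rev]⟩
    simp only [Pi.sub_apply, Pi.single_apply, h1, G.rev.injective.eq_iff]
    ring

theorem current_mem_range (l : List D) (d : D) : G.current l d ∈ (Int.castRingHom ℂ).range := by
  classical
  induction l with
  | nil => exact zero_mem _
  | cons d' l ih =>
    refine add_mem (sub_mem ?_ ?_) ih <;>
    · rw [Pi.single_apply]
      split_ifs
      exacts [one_mem _, zero_mem _]

variable [Fintype D]

theorem eq_zero_of_out_eq_zero {α : D → ℂ} (hα : α ∈ G.forms)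
    (h : ∀ e : G.Edge, α (Quotient.out e) = 0) (d : D) : α d = 0 := by
  have hsum := G.sum_eq_sum_edge (fun d => ‖α d‖)
  have hz : ∑ d, ‖α d‖ = 0 := by
    rw [hsum]
    refine Finset.sum_eq_zero fun e _ => ?_
    rw [hα, norm_neg, h, norm_zero, add_zero]
  have := (Finset.sum_eq_zero_iff_of_nonneg (fun d _ => norm_nonneg (α d))).1 hz d (Finset.mem_univ d)
  exact norm_eq_zero.1 this

theorem finrank_forms_le : Module.finrank ℂ G.forms ≤ Nat.card G.Edge := by
  let f : G.forms →ₗ[ℂ] (G.Edge → ℂ) :=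
    { toFun := fun α e => α.1 (Quotient.out e)
      map_add' := fun _ _ => rfl
      map_smul' := fun _ _ => rfl }
  have hf : Function.Injective f := by
    refine (injective_iff_map_eq_zero f).2 fun α hα => ?_
    exact Subtype.ext (funext (eq_zero_of_out_eq_zero α.2 (congrFun hα)))
  have := LinearMap.finrank_le_finrank_of_injective hf
  rwa [Module.finrank_fintype_fun_eq_card, ← Nat.card_eq_fintype_card] at this

/-- The Laplacian of a weighted graph. -/
def laplacian (c : G.Edge → ℝ) : (G.Vertex → ℂ) →ₗ[ℂ] (G.Vertex → ℂ) :=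
  G.div ∘ₗ
    { toFun := fun φ d => (c (Quotient.mk _ d) : ℂ) * (φ (G.tgt d) - φ (G.src d))
      map_add' := fun φ ψ => by ext d; simp; ring
      map_smul' := fun r φ => by ext d; simp; ring }

theorem laplacian_apply (c : G.Edge → ℝ) (φ : G.Vertex → ℂ) :
    laplacian c φ = G.div fun d => (c (Quotient.mk _ d) : ℂ) * (φ (G.tgt d) - φ (G.src d)) := rfl

/-- Green's formula against the conjugate of `φ` turns the Laplacian into a sum of nonnegative
terms. -/
theorem grad_eq_zero_of_laplacian {c : G.Edge → ℝ} (hc : ∀ e, 0 < c e) {φ : G.Vertex → ℂ}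
    (h : laplacian c φ = 0) (d : D) : φ (G.tgt d) = φ (G.src d) := by
  have h1 := G.sum_sub_mul (fun v => star (φ v)) (mul_mem_forms c (grad_mem_forms φ))
  rw [← laplacian_apply, h] at h1
  have h2 : ∑ d, c (Quotient.mk _ d) * Complex.normSq (φ (G.tgt d) - φ (G.src d)) = 0 := by
    have : ((∑ d, c (Quotient.mk _ d) * Complex.normSq (φ (G.tgt d) - φ (G.src d)) : ℝ) : ℂ) = 0 := by
      push_cast
      simp only [Complex.normSq_eq_conj_mul_self]
      refine Eq.trans (Finset.sum_congr rfl fun d _ => ?_) (h1.trans (by simp))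
      simp; ring
    exact_mod_cast this
  have := (Finset.sum_eq_zero_iff_of_nonneg (fun d _ =>
    mul_nonneg (hc _).le (Complex.normSq_nonneg _))).1 h2 d (Finset.mem_univ d)
  rcases mul_eq_zero.1 this with h3 | h3
  · exact absurd h3 (hc _).ne'
  · exact sub_eq_zero.1 (Complex.normSq_eq_zero.1 h3)

theorem div_single [DecidableEq D] [DecidableEq G.Vertex] (d : D) :
    G.div (Pi.single d 1) = Pi.single (G.src d) 1 := by
  ext v
  have h : G.div (Pi.single d 1) v = ∑ d' with G.src d' = v, (Pi.single d 1 : D → ℂ) d' :=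
    Finset.sum_congr (by congr) fun _ _ => rfl
  simp [h, Pi.single_apply, eq_comm]

theorem div_current [DecidableEq G.Vertex] {v w : G.Vertex} {l : List D} (hl : G.IsWalk v l w) :
    G.div (G.current l) = Pi.single v 1 - Pi.single w 1 := by
  classical
  induction l generalizing v with
  | nil =>
    obtain rfl : v = w := hl
    rw [sub_self]; exact map_zero _
  | cons d l ih =>
    rw [current, map_add, map_sub, ih hl.2, div_single, div_single, hl.1]
    change _ - Pi.single (G.tgt d) 1 + _ = _
    ext u
    rw [Pi.add_apply, Pi.sub_apply, Pi.sub_apply, Pi.sub_apply]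
    convert sub_add_sub_cancel _ _ _ using 2

theorem current_mem_coclosed {v : G.Vertex} {l : List D} (hl : G.IsWalk v l v) :
    G.current l ∈ G.coclosed := by
  classical
  refine mem_coclosed.2 ⟨current_mem_forms l, fun w => ?_⟩
  rw [div_current hl]; simp

/-- The factor 2 appears because a current charges each dart of the path and its reverse, with
opposite signs. -/
theorem sum_mul_current {α : D → ℂ} (hα : α ∈ G.forms) (l : List D) :
    ∑ d, α d * G.current l d = 2 * (l.map α).sum := by
  classical
  induction l with
  | nil => simp [current]
  | cons d l ih =>
    simp only [current, Pi.add_apply, Pi.sub_apply, mul_add, mul_sub, Finset.sum_add_distrib,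
      Finset.sum_sub_distrib, ih]
    simp [Pi.single_apply, hα d]
    ring

end CellMap

/-! ### Dimension count and Riemann's bilinear relation. -/

namespace TorusDecomposition

open CellMap

variable {D : Type*} [Fintype D] {G : TorusDecomposition D} {o : G.Vertex} {γ₁ γ₂ : G.Walk o o}

theorem exists_coverVertex (o v : G.Vertex) : ∃ x : G.CoverVertex o, x.1 = v := by
  obtain ⟨l, hl⟩ := G.connected o v
  exact ⟨CoverVertex.ofWalk l hl, rfl⟩

theorem eq_of_tgt_eq_src {φ : G.Vertex → ℂ} (h : ∀ d, φ (G.tgt d) = φ (G.src d)) (v w : G.Vertex) :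
    φ v = φ w := by
  obtain ⟨y, rfl⟩ := exists_coverVertex v w
  have := CoverVertex.sub_mem ⊥ (fun x : G.CoverVertex v => φ x.1) (fun e => by
    rw [AddSubgroup.mem_bot, ← e.src_eq, sub_eq_zero]; exact h e.dart)
    (CoverVertex.ofWalk (v := v) [] rfl) y
  exact (sub_eq_zero.1 (AddSubgroup.mem_bot.1 this)).symm

theorem HasPeriods.eq_of_diff_eq_zero (hγ : Generate γ₁ γ₂) {h : G.CoverVertex o → ℂ} {a b : ℂ}
    (hh : HasPeriods γ₁ γ₂ h a b) (h0 : ∀ d, diff h d = 0) (x y : G.CoverVertex o) : h x = h y := by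
  have := CoverVertex.sub_mem ⊥ h (fun e => by
    rw [hh.sub_eq_diff hγ, h0]; exact zero_mem _) y x
  exact sub_eq_zero.1 (by simpa using this)

theorem HasFacePeriods.eq_of_codiff_eq_zero (hγ : Generate γ₁ γ₂) {g : G.CoverFace o → ℂ} {a b : ℂ}
    (hg : HasFacePeriods γ₁ γ₂ g a b) (h0 : ∀ d, codiff g d = 0) (E F : G.CoverFace o) :
    g E = g F := by
  have := CoverFace.sub_mem ⊥ g (fun e => by
    rw [hg.sub_eq_codiff hγ, h0]; exact zero_mem _) F E
  exact sub_eq_zero.1 (by simpa using this)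

theorem HasPeriods.sub_mem_of_eq (hγ : Generate γ₁ γ₂) {h : G.CoverVertex o → ℂ} {a b : ℂ}
    (hh : HasPeriods γ₁ γ₂ h a b) {H : AddSubgroup ℂ} (ha : a ∈ H) (hb : b ∈ H)
    {x y : G.CoverVertex o} (hxy : x.1 = y.1) : h y - h x ∈ H := by
  have hout : G.src (Quotient.out x.1) = x.1 := Quotient.out_eq x.1
  refine hγ.sub_mem H (fun e => h e.src) (fun e => ?_) (fun e => ?_)
    (e := ⟨x, Quotient.out x.1, hout⟩) (e' := ⟨y, Quotient.out x.1, hout.trans hxy⟩) rfl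
  · change h (γ₁.onVertex e.src) - _ ∈ H
    rw [(hh _).1]; simpa using ha
  · change h (γ₂.onVertex e.src) - _ ∈ H
    rw [(hh _).2]; simpa using hb

theorem HasPeriods.exists_base (hγ : Generate γ₁ γ₂) {h : G.CoverVertex o → ℂ}
    (hh : HasPeriods γ₁ γ₂ h 0 0) : ∃ φ : G.Vertex → ℂ, h = fun x => φ x.1 := by
  choose s hs using exists_coverVertex (G := G) o
  refine ⟨fun v => h (s v), funext fun x => ?_⟩
  have := hh.sub_mem_of_eq hγ (H := ⊥) (zero_mem _) (zero_mem _) (hs x.1)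
  exact sub_eq_zero.1 (by simpa using this)

/-- Subtracting the value at a chosen lift of each vertex keeps the periods and leaves only
combinations of them. -/
theorem HasPeriods.exists_mem (hγ : Generate γ₁ γ₂) {h : G.CoverVertex o → ℂ} {a b : ℂ}
    (hh : HasPeriods γ₁ γ₂ h a b) {H : AddSubgroup ℂ} (ha : a ∈ H) (hb : b ∈ H) :
    ∃ h', HasPeriods γ₁ γ₂ h' a b ∧ ∀ x, h' x ∈ H := by
  choose s hs using exists_coverVertex (G := G) o
  refine ⟨fun x => h x - h (s x.1), fun x => ⟨?_, ?_⟩, fun x => hh.sub_mem_of_eq hγ ha hb (hs x.1)⟩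
  · have h1 : (γ₁.onVertex x).1 = x.1 := rfl
    simp only [(hh x).1, h1]; ring
  · have h1 : (γ₂.onVertex x).1 = x.1 := rfl
    simp only [(hh x).2, h1]; ring

theorem sum_diff_eq (hγ : Generate γ₁ γ₂) {h : G.CoverVertex o → ℂ} {a b : ℂ}
    (hh : HasPeriods γ₁ γ₂ h a b) (l : List D) {v w : G.Vertex} {k : List D}
    (hk : G.IsWalk o k v) (hl : G.IsWalk v l w) :
    (l.map (diff h)).sum =
      h (CoverVertex.ofWalk _ (hk.append hl)) - h (CoverVertex.ofWalk k hk) := by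
  induction l generalizing v k with
  | nil =>
    rw [CoverVertex.ofWalk_congr (hk.append hl) hk (by simp) hl.symm]; simp
  | cons d l ih =>
    obtain ⟨hs, hl⟩ := hl
    have hd : G.IsWalk v [d] (G.tgt d) := ⟨hs, rfl⟩
    have h1 := hh.sub_eq_diff hγ ⟨CoverVertex.ofWalk k hk, d, hs⟩
    rw [List.map_cons, List.sum_cons, ih (hk.append hd) hl, ← h1,
      CoverVertex.ofWalk_congr ((hk.append hd).append hl) (hk.append (l' := d :: l) ⟨hs, hl⟩)
        (by simp) rfl]
    change h (CoverVertex.ofWalk (k ++ [d]) (hk.append hd)) - _ + _ = _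
    ring

theorem finrank_ker_laplacian_le {c : G.Edge → ℝ} (hc : ∀ e, 0 < c e) :
    Module.finrank ℂ (LinearMap.ker (laplacian c)) ≤ 1 := by
  refine finrank_le_one ⟨fun _ => 1, ?_⟩ fun φ => ?_
  · rw [LinearMap.mem_ker, laplacian_apply]
    simp only [sub_self, mul_zero]
    exact map_zero _
  · rcases isEmpty_or_nonempty G.Vertex with h | ⟨⟨v⟩⟩
    · exact ⟨0, Subtype.ext (funext fun v => h.elim v)⟩
    · refine ⟨φ.1 v, Subtype.ext (funext fun w => ?_)⟩
      have := eq_of_tgt_eq_src (grad_eq_zero_of_laplacian hc (LinearMap.mem_ker.1 φ.2)) v w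
      simp [this]

/-- The divergence of forms has rank at least that of a Laplacian, hence at least |V| − 1. Its
kernel has dimension at most |E| − |V| + 1, and Euler characteristic 0 makes this |F| + 1. -/
theorem finrank_coclosed_le :
    Module.finrank ℂ G.coclosed ≤ Nat.card G.Face + 1 := by
  have h1 := LinearMap.finrank_range_add_finrank_ker (G.div.domRestrict G.forms)
  have h2 : Module.finrank ℂ (LinearMap.ker (G.div.domRestrict G.forms)) =
      Module.finrank ℂ G.coclosed := by
    rw [LinearMap.ker_domRestrict, ← Submodule.finrank_map_subtype_eq, Submodule.map_comap_subtype]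
    rfl
  let c : G.Edge → ℝ := fun _ => 1
  have h3 := LinearMap.finrank_range_add_finrank_ker (laplacian c)
  have h4 := finrank_ker_laplacian_le (c := c) fun _ => one_pos
  have h5 : LinearMap.range (laplacian c) ≤ LinearMap.range (G.div.domRestrict G.forms) := by
    rintro _ ⟨φ, rfl⟩
    exact ⟨⟨_, mul_mem_forms c (grad_mem_forms φ)⟩, rfl⟩
  have h6 := Submodule.finrank_mono h5
  have h7 := G.finrank_forms_le
  have h8 := G.euler
  rw [Module.finrank_fintype_fun_eq_card, ← Nat.card_eq_fintype_card] at h3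
  omega

/-- Every coclosed form is the sum of an exact one and of a combination of two forms with
independent periods. -/
theorem exists_codiff_eq (hγ : Generate γ₁ γ₂) {f₁ f₂ : G.CoverFace o → ℂ}
    (hf₁ : HasFacePeriods γ₁ γ₂ f₁ 1 0) (hf₂ : HasFacePeriods γ₁ γ₂ f₂ 0 1) {α : D → ℂ}
    (hα : α ∈ G.coclosed) : ∃ g a b, HasFacePeriods γ₁ γ₂ g a b ∧ codiff g = α := by
  let g : (G.Face → ℂ) × ℂ × ℂ → G.CoverFace o → ℂ := fun p F =>
    p.1 F.proj + (p.2.1 * f₁ F + p.2.2 * f₂ F)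
  have hg : ∀ p, HasFacePeriods γ₁ γ₂ (g p) p.2.1 p.2.2 := by
    intro p
    have := (HasFacePeriods.base (γ₁ := γ₁) (γ₂ := γ₂) p.1).add
      ((hf₁.const_mul p.2.1).add (hf₂.const_mul p.2.2))
    simpa using this
  let Φ : ((G.Face → ℂ) × ℂ × ℂ) →ₗ[ℂ] (D → ℂ) :=
    { toFun := fun p => codiff (g p)
      map_add' := fun p q => by ext d; simp [codiff, g]; ring
      map_smul' := fun r p => by ext d; simp [codiff, g]; ring }
  have hrange : LinearMap.range Φ ≤ G.coclosed := by
    rintro _ ⟨p, rfl⟩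
    exact (hg p).codiff_mem_coclosed hγ
  have hker : Module.finrank ℂ (LinearMap.ker Φ) ≤ 1 := by
    let e := G.lift o (Quotient.out o)
    refine finrank_le_one ⟨(fun _ => 1, 0, 0), ?_⟩ fun p => ?_
    · rw [LinearMap.mem_ker]
      ext d
      simp [Φ, g, codiff]
    · have hconst := (hg p).eq_of_codiff_eq_zero hγ (congrFun (LinearMap.mem_ker.1 p.2))
      have h1 : p.1.2.1 = 0 := by
        have := (hg p e.left).1
        rwa [hconst _ e.left, left_eq_add] at this
      have h2 : p.1.2.2 = 0 := by
        have := (hg p e.left).2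
        rwa [hconst _ e.left, left_eq_add] at this
      refine ⟨p.1.1 e.left.proj, Subtype.ext (Prod.ext (funext fun F => ?_) (Prod.ext ?_ ?_))⟩
      · have := hconst e.left (G.lift o (Quotient.out F)).left
        simp only [g, h1, h2, zero_mul, add_zero] at this
        have hF : (G.lift o (Quotient.out F)).left.proj = F := by
          change Quotient.mk _ (G.lift o (Quotient.out F)).dart = F
          rw [lift_dart]
          exact Quotient.out_eq F
        rw [hF] at this
        simp [this]
      · simp [h1]
      · simp [h2]
  have hdim := LinearMap.finrank_range_add_finrank_ker Φ
  have hle := finrank_coclosed_le (G := G)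
  simp only [Module.finrank_prod, Module.finrank_fintype_fun_eq_card, Module.finrank_self,
    ← Nat.card_eq_fintype_card] at hdim
  -- The source of `Φ` has dimension |F| + 2 and the kernel at most 1 (constants), so the range
  -- reaches the upper bound |F| + 1.
  have heq := Submodule.eq_of_le_of_finrank_le hrange (by omega)
  rw [← heq] at hα
  obtain ⟨p, hp⟩ := hα
  exact ⟨g p, _, _, hg p, hp⟩

/-- The pairing depends on `g` only through its periods and, after the antisymmetric area form
exchanges the roles, on `y` only through its own. Both may thus be replaced by combinations of `X`
and `Y`. -/
theorem sum_diff_mul_codiff_of_area (hγ : Generate γ₁ γ₂) {X Y : G.CoverVertex o → ℂ}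
    (hX : HasPeriods γ₁ γ₂ X 1 0) (hY : HasPeriods γ₁ γ₂ Y 0 1) {y : G.CoverVertex o → ℂ}
    {g : G.CoverFace o → ℂ} {p q r s : ℂ}
    (hy : HasPeriods γ₁ γ₂ y p q) (hg : HasFacePeriods γ₁ γ₂ g r s) :
    ∑ d, diff y d * codiff g d = 2 * areaForm X Y * (p * s - q * r) := by
  have hx : HasPeriods γ₁ γ₂ (fun v => r * X v + s * Y v) r s := by
    simpa using (hX.const_mul r).add (hY.const_mul s)
  have hf : HasFacePeriods γ₁ γ₂ (fun F => p * X F.corner + q * Y F.corner) p q := by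
    simpa using (hX.corner.const_mul p).add (hY.corner.const_mul q)
  rw [sum_diff_mul_codiff hγ hx hg hy, areaForm_swap]
  have h1 := sum_diff_mul_codiff hγ hy hf hx
  have hXX := sum_diff_mul_codiff hγ hX hX.corner hX
  have hXY := sum_diff_mul_codiff hγ hY hY.corner hX
  have hYX := sum_diff_mul_codiff hγ hX hX.corner hY
  have hYY := sum_diff_mul_codiff hγ hY hY.corner hY
  have hX0 : areaForm X X = 0 := self_eq_neg.1 (areaForm_swap X X)
  have hY0 : areaForm Y Y = 0 := self_eq_neg.1 (areaForm_swap Y Y)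
  have h2 : ∑ d, diff (fun v => r * X v + s * Y v) d *
      codiff (fun F : G.CoverFace o => p * X F.corner + q * Y F.corner) d =
      r * p * (∑ d, diff X d * codiff (fun F => X F.corner) d) +
      r * q * (∑ d, diff X d * codiff (fun F => Y F.corner) d) +
      s * p * (∑ d, diff Y d * codiff (fun F => X F.corner) d) +
      s * q * (∑ d, diff Y d * codiff (fun F => Y F.corner) d) := by
    simp only [Finset.mul_sum, ← Finset.sum_add_distrib]
    refine Finset.sum_congr rfl fun d _ => ?_
    simp only [diff, codiff]; ring
  rw [hXX, hXY, hYX, hYY, hX0, hY0, areaForm_swap Y X, h1] at h2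
  linear_combination -h2

namespace Marking

variable (M : G.Marking)

theorem exists_periods : ∃ X Y, HasPeriods M.γ₁ M.γ₂ X 1 0 ∧ HasPeriods M.γ₁ M.γ₂ Y 0 1 ∧
    ∃ A : ℝ, 0 < A ∧ areaForm X Y = A := by
  obtain ⟨h, hh, hpos⟩ := M.positive
  refine ⟨_, _, by simpa using hh.ofReal_re, by simpa using hh.ofReal_im, _, hpos,
    (signedArea_eq_areaForm h).symm⟩

theorem exists_codiff_eq {α : D → ℂ} (hα : α ∈ G.coclosed) :
    ∃ g a b, HasFacePeriods M.γ₁ M.γ₂ g a b ∧ codiff g = α := by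
  obtain ⟨X, Y, hX, hY, -⟩ := M.exists_periods
  exact TorusDecomposition.exists_codiff_eq M.generate hX.corner hY.corner hα

/-- The torus has area one under a map with the periods of the square torus: its area is an
integer, and so is the inverse. -/
theorem areaForm_eq_one {X Y} (hX : HasPeriods M.γ₁ M.γ₂ X 1 0) (hY : HasPeriods M.γ₁ M.γ₂ Y 0 1) :
    areaForm X Y = 1 := by
  obtain ⟨X', Y', hX', hY', A, hA, hA'⟩ := M.exists_periods
  -- The same pairing is evaluated with either pair as reference.
  have hindep : areaForm X Y = A := by
    have h1 := sum_diff_mul_codiff_of_area M.generate hX' hY' hX hY.corner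
    have h2 := sum_diff_mul_codiff_of_area M.generate hX hY hX hY.corner
    rw [h1, hA'] at h2
    linear_combination -h2 / 2
  set R := (Int.castRingHom ℂ).range
  obtain ⟨X₀, hX₀, hX₀R⟩ := hX.exists_mem M.generate (H := R.toAddSubgroup) R.one_mem R.zero_mem
  obtain ⟨Y₀, hY₀, hY₀R⟩ := hY.exists_mem M.generate (H := R.toAddSubgroup) R.zero_mem R.one_mem
  have hAR : (A : ℂ) ∈ R := by
    have h1 := sum_diff_mul_codiff_of_area M.generate hX hY hX₀ hY₀.corner
    have h2 : (A : ℂ) = ∑ e : G.Edge, diff X₀ (Quotient.out e) *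
        codiff (fun F => Y₀ F.corner) (Quotient.out e) := by
      rw [G.sum_eq_sum_edge] at h1
      simp only [hX₀.diff_rev M.generate, hY₀.corner.codiff_rev M.generate, neg_mul_neg,
        ← two_mul, ← Finset.mul_sum] at h1
      rw [hindep] at h1
      linear_combination -h1 / 2
    rw [h2]
    exact R.sum_mem fun e _ => R.mul_mem (R.sub_mem (hX₀R _) (hX₀R _))
      (R.sub_mem (hY₀R _) (hY₀R _))
  -- Pairing the current along γ₁ with `X` gives twice the period of `X` along γ₁, which is 1; hence
  -- `A * s = 1`. The current is integral, so the period `s` is an integer.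
  obtain ⟨g, r, s, hg, hgα⟩ := M.exists_codiff_eq (current_mem_coclosed M.γ₁.2)
  have hper : A * s = 1 := by
    have h1 := sum_diff_mul_codiff_of_area M.generate hX hY hX hg
    rw [hgα, sum_mul_current (hX.diff_rev M.generate),
      sum_diff_eq M.generate hX M.γ₁.1 (k := []) rfl M.γ₁.2, hindep] at h1
    have h2 : X (CoverVertex.ofWalk (M.γ₁.1 ++ []) (M.γ₁.2.append rfl)) = _ :=
      (hX (CoverVertex.ofWalk (v := M.base) [] rfl)).1
    have hnil : G.IsWalk M.base [] M.base := rfl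
    rw [CoverVertex.ofWalk_congr (hnil.append M.γ₁.2) (M.γ₁.2.append hnil) (by simp) rfl,
      h2] at h1
    linear_combination -h1 / 2
  have hsR : s ∈ R := by
    let F := (G.lift M.base (Quotient.out M.base)).left
    have := CoverFace.sub_mem R.toAddSubgroup g (fun e => by
      rw [hg.sub_eq_codiff M.generate, hgα]
      exact current_mem_range _ _) F (M.γ₂.onFace F)
    rw [(hg F).2, add_sub_cancel_left] at this
    exact this
  obtain ⟨n, hn⟩ := hAR
  obtain ⟨m, hm⟩ := hsR
  rw [eq_intCast] at hn hm
  have hnA : (n : ℝ) = A := by exact_mod_cast hn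
  have hnpos : 0 < n := by rw [← hnA] at hA; exact_mod_cast hA
  rw [← hn, ← hm] at hper
  have hnm : n * m = 1 := by exact_mod_cast hper
  rw [hindep, ← hn, Int.eq_one_or_neg_one_of_mul_eq_one hnm |>.resolve_right (by omega)]
  simp

/-- Riemann's bilinear relation. -/
theorem sum_diff_mul_codiff {y : G.CoverVertex M.base → ℂ} {g : G.CoverFace M.base → ℂ}
    {p q r s : ℂ} (hy : HasPeriods M.γ₁ M.γ₂ y p q) (hg : HasFacePeriods M.γ₁ M.γ₂ g r s) :
    ∑ d, diff y d * codiff g d = 2 * (p * s - q * r) := by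
  obtain ⟨X, Y, hX, hY, -⟩ := M.exists_periods
  rw [sum_diff_mul_codiff_of_area M.generate hX hY hy hg, M.areaForm_eq_one hX hY]
  ring

end Marking

end TorusDecomposition

/-! ### Existence, uniqueness and energy of harmonic maps. -/

namespace TorusDecomposition

open CellMap

variable {D : Type*} [Fintype D] {G : TorusDecomposition D} {o : G.Vertex} {γ₁ γ₂ : G.Walk o o}

theorem sum_div {α : D → ℂ} (hα : α ∈ G.forms) : ∑ v, G.div α v = 0 := by
  have := G.sum_sub_mul (fun _ => 1) hα
  simp only [sub_self, zero_mul, Finset.sum_const_zero, one_mul] at this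
  simpa using this.symm

theorem exists_laplacian_eq [Nonempty G.Vertex] {c : G.Edge → ℝ} (hc : ∀ e, 0 < c e)
    {ψ : G.Vertex → ℂ} (hψ : ∑ v, ψ v = 0) : ∃ φ, laplacian c φ = ψ := by
  have hcard : (Fintype.card G.Vertex : ℂ) ≠ 0 := Nat.cast_ne_zero.2 Fintype.card_ne_zero
  have hlap : ∀ φ, ∑ v, laplacian c φ v = 0 := fun φ =>
    sum_div (mul_mem_forms c (grad_mem_forms φ))
  -- Adding the total of `φ` kills the constants in the kernel, so `T` is bijective. On a right-hand
  -- side of sum zero the added term vanishes.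
  let T : (G.Vertex → ℂ) →ₗ[ℂ] (G.Vertex → ℂ) := laplacian c +
    { toFun := fun φ _ => ∑ v, φ v
      map_add' := fun φ ψ => by ext; simp [Finset.sum_add_distrib]
      map_smul' := fun r φ => by ext; simp [Finset.mul_sum] }
  have hT : ∀ φ v, T φ v = laplacian c φ v + ∑ w, φ w := fun _ _ => rfl
  have hsum : ∀ φ, ∑ v, T φ v = Fintype.card G.Vertex * ∑ w, φ w := fun φ => by
    simp only [hT, Finset.sum_add_distrib, hlap, zero_add, Finset.sum_const, nsmul_eq_mul,
      Finset.card_univ]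
  have hmean : ∀ φ, ∑ v, T φ v = 0 → T φ = laplacian c φ := fun φ h => by
    rw [hsum] at h
    ext v
    rw [hT, (mul_eq_zero.1 h).resolve_left hcard, add_zero]
  have hinj : Function.Injective T := by
    refine (injective_iff_map_eq_zero T).2 fun φ h => ?_
    have h0 : ∑ v, T φ v = 0 := by simp [h]
    have hconst := eq_of_tgt_eq_src (grad_eq_zero_of_laplacian hc ((hmean φ h0).symm.trans h))
    ext v
    rw [hsum, Finset.sum_congr rfl fun w _ => hconst w v] at h0
    simpa [hcard] using h0
  obtain ⟨φ, rfl⟩ := LinearMap.injective_iff_surjective.1 hinj ψ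
  exact ⟨φ, (hmean φ hψ).symm⟩

/-- The weighted increments of a function. -/
def flow (c : G.Edge → ℝ) (h : G.CoverVertex o → ℂ) (d : D) : ℂ :=
  (c (Quotient.mk _ d) : ℂ) * diff h d

theorem energy_eq_sum (hγ : Generate γ₁ γ₂) (c : G.Edge → ℝ) {h : G.CoverVertex o → ℂ} {a b : ℂ}
    (hh : HasPeriods γ₁ γ₂ h a b) :
    energy c h = (1 / 4) * ∑ d, c (Quotient.mk _ d) * ‖diff h d‖ ^ 2 := by
  have hout : ∀ e : G.Edge, (Quotient.mk _ (Quotient.out e) : G.Edge) = e := Quotient.out_eq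
  rw [G.sum_eq_sum_edge]
  simp only [edge_rev, hh.diff_rev hγ, norm_neg, ← two_mul, ← Finset.mul_sum, hout]
  rw [energy]
  simp only [diff]
  ring

/-- The energy of a perturbation of a map with coclosed flow. -/
theorem energy_add_base (hγ : Generate γ₁ γ₂) {c : G.Edge → ℝ} {h : G.CoverVertex o → ℂ} {a b : ℂ}
    (hh : HasPeriods γ₁ γ₂ h a b) (hflow : flow c h ∈ G.coclosed) (φ : G.Vertex → ℂ) :
    energy c (fun x => h x + φ x.1) = energy c h +
      (1 / 4) * ∑ d, c (Quotient.mk _ d) * ‖φ (G.tgt d) - φ (G.src d)‖ ^ 2 := by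
  have hφ : HasPeriods γ₁ γ₂ (fun x => φ x.1) 0 0 := HasPeriods.base φ
  rw [energy_eq_sum hγ c (hh.add hφ), energy_eq_sum hγ c hh, ← mul_add, ← Finset.sum_add_distrib]
  have h1 := G.sum_sub_mul (fun v => star (φ v)) (mem_coclosed.1 hflow).1
  have h2 : ∑ d, (star (φ (G.tgt d) - φ (G.src d)) * flow c h d) = 0 := by
    simp only [star_sub]
    rw [h1]
    simp [(mem_coclosed.1 hflow).2]
  have h3 : ∑ d, 2 * (star (φ (G.tgt d) - φ (G.src d)) * flow c h d).re = 0 := by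
    rw [← Finset.mul_sum, ← Complex.re_sum, h2]; simp
  rw [← add_zero (∑ d, (_ + _)), ← h3, ← Finset.sum_add_distrib]
  congr 1
  refine Finset.sum_congr rfl fun d _ => ?_
  rw [diff_add, diff_base]
  simp only [Complex.sq_norm, Complex.normSq_apply, flow]
  simp
  ring

theorem exists_flow_mem_coclosed (M : G.Marking) {c : G.Edge → ℝ} (hc : ∀ e, 0 < c e) (a b : ℂ) :
    ∃ h, HasPeriods M.γ₁ M.γ₂ h a b ∧ flow c h ∈ G.coclosed := by
  obtain ⟨X, Y, hX, hY, -⟩ := M.exists_periods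
  have h₀ : HasPeriods M.γ₁ M.γ₂ (fun x => a * X x + b * Y x) a b := by
    simpa using (hX.const_mul a).add (hY.const_mul b)
  set k := fun x => a * X x + b * Y x
  have hforms : flow c k ∈ G.forms := mul_mem_forms c (h₀.diff_rev M.generate)
  have : Nonempty G.Vertex := ⟨M.base⟩
  obtain ⟨φ, hφ⟩ := exists_laplacian_eq hc (ψ := -G.div (flow c k)) (by simp [sum_div hforms])
  have hper : HasPeriods M.γ₁ M.γ₂ (fun x => k x + φ x.1) a b := by
    simpa using h₀.add (HasPeriods.base φ)
  refine ⟨_, hper, mul_mem_forms c (hper.diff_rev M.generate), ?_⟩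
  have : flow c (fun x => k x + φ x.1) = flow c k +
      fun d => (c (Quotient.mk _ d) : ℂ) * (φ (G.tgt d) - φ (G.src d)) := by
    ext d
    simp only [flow, diff_add, diff_base, Pi.add_apply, mul_add]
  rw [SetLike.mem_coe, LinearMap.mem_ker, this, map_add, ← laplacian_apply, hφ, add_neg_cancel]

theorem exists_eq_add_base (hγ : Generate γ₁ γ₂) {h h' : G.CoverVertex o → ℂ} {a b : ℂ}
    (hh : HasPeriods γ₁ γ₂ h a b) (hh' : HasPeriods γ₁ γ₂ h' a b) :
    ∃ φ : G.Vertex → ℂ, h' = fun x => h x + φ x.1 := by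
  have h0 : HasPeriods γ₁ γ₂ (fun x => h' x + (-1) * h x) 0 0 := by
    simpa using hh'.add (hh.const_mul (-1))
  obtain ⟨φ, hφ⟩ := h0.exists_base hγ
  refine ⟨φ, funext fun x => ?_⟩
  rw [← congrFun hφ x]; ring

theorem energy_le_of_flow (hγ : Generate γ₁ γ₂) {c : G.Edge → ℝ} (hc : ∀ e, 0 < c e)
    {h h' : G.CoverVertex o → ℂ} {a b : ℂ} (hh : HasPeriods γ₁ γ₂ h a b)
    (hflow : flow c h ∈ G.coclosed) (hh' : HasPeriods γ₁ γ₂ h' a b) :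
    energy c h ≤ energy c h' ∧ (energy c h' ≤ energy c h → ∃ t : ℂ, ∀ x, h' x = h x + t) := by
  obtain ⟨φ, rfl⟩ := exists_eq_add_base hγ hh hh'
  rw [energy_add_base hγ hh hflow]
  have hnn : ∀ d ∈ Finset.univ, 0 ≤ c (Quotient.mk _ d) * ‖φ (G.tgt d) - φ (G.src d)‖ ^ 2 :=
    fun d _ => mul_nonneg (hc _).le (sq_nonneg _)
  have hsum := Finset.sum_nonneg hnn
  refine ⟨by linarith, fun hle => ⟨φ o, fun x => ?_⟩⟩
  have h0 := (Finset.sum_eq_zero_iff_of_nonneg hnn).1 (le_antisymm (by linarith) hsum)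
  have hconst := eq_of_tgt_eq_src (φ := φ) (fun d => by
    have := (mul_eq_zero.1 (h0 d (Finset.mem_univ d))).resolve_left (hc _).ne'
    exact sub_eq_zero.1 (norm_eq_zero.1 (pow_eq_zero_iff two_ne_zero |>.1 this)))
  simp only [hconst x.1 o]

/-! ### Conjugate maps and the Gram matrix. -/

namespace Marking

variable (M : G.Marking) {c : G.Edge → ℝ}

theorem isHarmonicMap_of_flow (hc : ∀ e, 0 < c e) {τ : UpperHalfPlane}
    {h : G.CoverVertex M.base → ℂ} (hh : M.IsMapTo τ h) (hflow : flow c h ∈ G.coclosed) :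
    M.IsHarmonicMap c τ h :=
  ⟨hh, fun _ hh' => (energy_le_of_flow M.generate hc hh hflow hh').1⟩

theorem isHarmonicMap_iff_of_flow (hc : ∀ e, 0 < c e) {τ : UpperHalfPlane}
    {h : G.CoverVertex M.base → ℂ} (hh : M.IsMapTo τ h) (hflow : flow c h ∈ G.coclosed)
    {h' : G.CoverVertex M.base → ℂ} :
    M.IsHarmonicMap c τ h' ↔ ∃ t : ℂ, ∀ x, h' x = h x + t := by
  constructor
  · rintro ⟨hh', hmin⟩
    exact (energy_le_of_flow M.generate hc hh hflow hh').2 (hmin h hh)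
  · rintro ⟨t, ht⟩
    have hh' : M.IsMapTo τ h' := fun x => by
      simp only [ht, (hh x).1, (hh x).2]
      exact ⟨by ring, by ring⟩
    refine M.isHarmonicMap_of_flow hc hh' ?_
    have : flow c h' = flow c h := by
      ext d; simp [flow, diff, ht]
    rwa [this]

theorem exists_isMapTo_flow_mem_coclosed (hc : ∀ e, 0 < c e) (τ : UpperHalfPlane) :
    ∃ h, M.IsMapTo τ h ∧ flow c h ∈ G.coclosed :=
  exists_flow_mem_coclosed M hc _ _

theorem IsHarmonicMap.flow_mem_coclosed (hc : ∀ e, 0 < c e) {M : G.Marking} {τ : UpperHalfPlane}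
    {h : G.CoverVertex M.base → ℂ} (hh : M.IsHarmonicMap c τ h) : flow c h ∈ G.coclosed := by
  obtain ⟨k, hk, hflow⟩ := M.exists_isMapTo_flow_mem_coclosed hc τ
  obtain ⟨t, ht⟩ := (M.isHarmonicMap_iff_of_flow hc hk hflow).1 hh
  have : flow c h = flow c k := by
    ext d; simp [flow, diff, ht]
  rwa [this]

theorem exists_isConjugate {h : G.CoverVertex M.base → ℂ} {a b : ℂ}
    (hh : HasPeriods M.γ₁ M.γ₂ h a b) (hflow : flow c h ∈ G.coclosed) :
    ∃ g, IsConjugate c h g := by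
  obtain ⟨g, r, s, hg, hgα⟩ := M.exists_codiff_eq (G.coclosed.smul_mem Complex.I hflow)
  refine ⟨g, fun e => ?_⟩
  rw [hg.sub_eq_codiff M.generate, hgα, hh.sub_eq_diff M.generate]
  simp only [Pi.smul_apply, flow, smul_eq_mul]
  ring

/-- A conjugate map has well-defined periods. -/
theorem _root_.TorusDecomposition.IsConjugate.hasFacePeriods {M : G.Marking}
    {h : G.CoverVertex M.base → ℂ} {a b : ℂ}
    (hh : HasPeriods M.γ₁ M.γ₂ h a b) (hflow : flow c h ∈ G.coclosed)
    {g : G.CoverFace M.base → ℂ} (hg : IsConjugate c h g) :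
    (∃ r s, HasFacePeriods M.γ₁ M.γ₂ g r s) ∧ ∀ d, codiff g d = Complex.I * flow c h d := by
  have hgc : ∀ e : G.CoverDart M.base, g e.left - g e.right = Complex.I * flow c h e.dart := by
    intro e
    rw [hg, hh.sub_eq_diff M.generate, flow]; ring
  refine ⟨?_, fun d => by rw [codiff, hgc, lift_dart]⟩
  obtain ⟨k, r, s, hk, hkα⟩ := M.exists_codiff_eq (G.coclosed.smul_mem Complex.I hflow)
  have hconst := CoverFace.sub_mem ⊥ (fun F => g F - k F) (fun e => by
    rw [AddSubgroup.mem_bot, sub_sub_sub_comm, hgc, hk.sub_eq_codiff M.generate, hkα]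
    simp)
  refine ⟨r, s, fun F => ?_⟩
  have h1 := sub_eq_zero.1 (AddSubgroup.mem_bot.1 (hconst F (M.γ₁.onFace F)))
  have h2 := sub_eq_zero.1 (AddSubgroup.mem_bot.1 (hconst F (M.γ₂.onFace F)))
  rw [(hk F).1] at h1
  rw [(hk F).2] at h2
  exact ⟨by linear_combination h1, by linear_combination h2⟩

/-- The energy of the harmonic maps, and the periods of their conjugates, in terms of the
Gram matrix of the harmonic forms. -/
theorem exists_gram (hc : ∀ e, 0 < c e) : ∃ a b e : ℝ, 0 < e ∧ 0 < a * e - b ^ 2 ∧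
    (∀ τ h, M.IsHarmonicMap c τ h →
      energy c h = (a + 2 * b * τ.re + e * (τ.re ^ 2 + τ.im ^ 2)) / (2 * τ.im)) ∧
    ∀ τ h g, M.IsHarmonicMap c τ h → IsConjugate c h g → ∀ k : ℝ, M.ProjectsTo g k τ ↔
      -Complex.I * (b + τ * e) = k ∧ Complex.I * (a + τ * b) = k * τ := by
  -- Periods 1 and i package both harmonic functions: as the weights are real, the real and
  -- imaginary parts of `k` are harmonic with periods (1,0) and (0,1).
  obtain ⟨k, hk, hkflow⟩ := exists_flow_mem_coclosed M hc 1 Complex.I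
  have hX := hk.ofReal_re
  have hY := hk.ofReal_im
  simp only [Complex.one_re, Complex.I_re, Complex.one_im, Complex.I_im, Complex.ofReal_one,
    Complex.ofReal_zero] at hX hY
  set X : G.CoverVertex M.base → ℂ := fun x => ((k x).re : ℂ)
  set Y : G.CoverVertex M.base → ℂ := fun x => ((k x).im : ℂ)
  let x : D → ℝ := fun d => (diff k d).re
  let y : D → ℝ := fun d => (diff k d).im
  have hx : ∀ d, diff X d = x d := fun d => by simp [diff, X, x]
  have hy : ∀ d, diff Y d = y d := fun d => by simp [diff, Y, y]
  let w : D → ℝ := fun d => c (Quotient.mk _ d)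
  have hw : ∀ d, 0 < w d := fun d => hc _
  have hkdiv : ∀ v, G.div (flow c k) v = 0 := (mem_coclosed.1 hkflow).2
  have hXflow : flow c X ∈ G.coclosed := by
    refine mem_coclosed.2 ⟨mul_mem_forms c (hX.diff_rev M.generate), fun v => ?_⟩
    have : G.div (flow c X) v = ((G.div (flow c k) v).re : ℂ) := by
      simp only [div, LinearMap.coe_mk, AddHom.coe_mk, Complex.re_sum, Complex.ofReal_sum]
      refine Finset.sum_congr rfl fun d _ => ?_
      simp [flow, hx, x]
    rw [this, hkdiv]; simp
  have hYflow : flow c Y ∈ G.coclosed := by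
    refine mem_coclosed.2 ⟨mul_mem_forms c (hY.diff_rev M.generate), fun v => ?_⟩
    have : G.div (flow c Y) v = ((G.div (flow c k) v).im : ℂ) := by
      simp only [div, LinearMap.coe_mk, AddHom.coe_mk, Complex.im_sum, Complex.ofReal_sum]
      refine Finset.sum_congr rfl fun d _ => ?_
      simp [flow, hy, y]
    rw [this, hkdiv]; simp
  have hdiff : ∀ τ h, M.IsHarmonicMap c τ h →
      ∀ d, diff h d = 1 / (√τ.im : ℝ) * (x d + τ * y d) := by
    intro τ h hh d
    have hper : M.IsMapTo τ (fun v => 1 / (√τ.im : ℝ) * (X v + τ * Y v)) := by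
      have := (hX.add (hY.const_mul τ)).const_mul (1 / (√τ.im : ℝ))
      simp only [mul_zero, mul_one, add_zero, zero_add] at this
      rwa [one_div_mul_eq_div] at this
    have hfl : flow c (fun v => 1 / (√τ.im : ℝ) * (X v + τ * Y v)) ∈ G.coclosed := by
      have : flow c (fun v => 1 / (√τ.im : ℝ) * (X v + τ * Y v)) =
          (1 / (√τ.im : ℝ) : ℂ) • (flow c X + (τ : ℂ) • flow c Y) := by
        ext d
        simp only [flow, diff, Pi.smul_apply, Pi.add_apply, smul_eq_mul]; ring
      rw [this]
      exact G.coclosed.smul_mem _ (G.coclosed.add_mem hXflow (G.coclosed.smul_mem _ hYflow))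
    obtain ⟨t, ht⟩ := (M.isHarmonicMap_iff_of_flow hc hper hfl).1 hh
    rw [← hx, ← hy]
    simp only [diff, ht]; ring
  -- The factor 1/2 turns sums over darts into sums over edges.
  set a := (1 / 2) * ∑ d, w d * (x d * x d) with ha
  set b := (1 / 2) * ∑ d, w d * (x d * y d) with hb
  set e := (1 / 2) * ∑ d, w d * (y d * y d) with he
  have hquad : ∀ p q : ℝ,
      p ^ 2 * a + 2 * p * q * b + q ^ 2 * e = (1 / 2) * ∑ d, w d * (p * x d + q * y d) ^ 2 := by
    intro p q
    simp only [ha, hb, he, Finset.mul_sum, ← Finset.sum_add_distrib]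
    exact Finset.sum_congr rfl fun d _ => by ring
  have hpos : ∀ p q : ℝ, q ≠ 0 ∨ p ≠ 0 → 0 < p ^ 2 * a + 2 * p * q * b + q ^ 2 * e := by
    intro p q hpq
    rw [hquad]
    have hnn : ∀ d ∈ Finset.univ, 0 ≤ w d * (p * x d + q * y d) ^ 2 :=
      fun d _ => mul_nonneg (hw d).le (sq_nonneg _)
    refine mul_pos (by norm_num) ((Finset.sum_nonneg hnn).lt_of_ne' fun h0 => ?_)
    have hz := (Finset.sum_eq_zero_iff_of_nonneg hnn).1 h0
    have hper : HasPeriods M.γ₁ M.γ₂ (fun v => p * X v + q * Y v) p q := by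
      simpa using (hX.const_mul p).add (hY.const_mul q)
    have hconst := hper.eq_of_diff_eq_zero M.generate (fun d => by
      have h1 := (mul_eq_zero.1 (hz d (Finset.mem_univ d))).resolve_left (hw d).ne'
      rw [diff_add, diff_const_mul, diff_const_mul, hx, hy]
      exact_mod_cast pow_eq_zero_iff two_ne_zero |>.1 h1)
    obtain ⟨v, -⟩ := exists_coverVertex M.base M.base
    have h1 := (hper v).1
    have h2 := (hper v).2
    dsimp only at h1 h2
    rw [hconst _ v, left_eq_add, Complex.ofReal_eq_zero] at h1 h2
    exact hpq.elim (fun h => h h2) (fun h => h h1)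
  have he0 : 0 < e := by simpa using hpos 0 1 (Or.inl one_ne_zero)
  refine ⟨a, b, e, he0, ?_, ?_, ?_⟩
  · have h1 := hpos e (-b) (Or.inr he0.ne')
    have h2 : 0 < e * (a * e - b ^ 2) := by linarith
    exact pos_of_mul_pos_right h2 he0.le
  · intro τ h hh
    rw [energy_eq_sum M.generate c hh.1]
    have hsq : ((√τ.im : ℝ)) ^ 2 = τ.im := Real.sq_sqrt τ.im_pos.le
    have hterm : ∀ d, c (Quotient.mk _ d) * ‖diff h d‖ ^ 2 =
        1 / τ.im * (w d * (x d * x d) + 2 * τ.re * (w d * (x d * y d)) +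
          (τ.re ^ 2 + τ.im ^ 2) * (w d * (y d * y d))) := by
      intro d
      rw [hdiff τ h hh d, norm_mul, mul_pow, norm_div, norm_one, Complex.norm_real, div_pow,
        one_pow, Real.norm_eq_abs, sq_abs, hsq, Complex.sq_norm, Complex.normSq_apply]
      simp
      ring
    simp only [hterm, ← Finset.mul_sum, Finset.sum_add_distrib]
    have := τ.im_pos.ne'
    rw [ha, hb, he]
    field_simp
    ring
  · intro τ h g hh hg k
    obtain ⟨⟨r, s, hrs⟩, hcod⟩ := hg.hasFacePeriods hh.1 (hh.flow_mem_coclosed hc)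
    -- By the bilinear relation, pairing with `X` isolates the period `s`, and pairing with `Y`
    -- isolates `-r`.
    have hs := M.sum_diff_mul_codiff hX hrs
    have hr := M.sum_diff_mul_codiff hY hrs
    have hσ : ((√τ.im : ℝ) : ℂ) ≠ 0 :=
      Complex.ofReal_ne_zero.2 (Real.sqrt_pos.2 τ.im_pos).ne'
    set σ : ℂ := ((√τ.im : ℝ) : ℂ)
    have hs' : s = Complex.I * (a + τ * b) / σ := by
      have : ∑ d, diff X d * codiff g d = 2 * (Complex.I * (a + τ * b) / σ) := by
        simp only [ha, hb]
        push_cast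
        rw [mul_left_comm (τ : ℂ), ← mul_add, Finset.mul_sum _ _ (τ : ℂ), ← Finset.sum_add_distrib,
          mul_left_comm Complex.I, mul_div_assoc, ← mul_assoc, Finset.mul_sum, Finset.sum_div,
          Finset.mul_sum]
        refine Finset.sum_congr rfl fun d _ => ?_
        rw [hcod, flow, hx, hdiff τ h hh]
        simp only [w]; ring
      rw [this] at hs
      linear_combination -hs / 2
    have hr' : r = -Complex.I * (b + τ * e) / σ := by
      have : ∑ d, diff Y d * codiff g d = 2 * (Complex.I * (b + τ * e) / σ) := by
        simp only [he, hb]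
        push_cast
        rw [mul_left_comm (τ : ℂ), ← mul_add, Finset.mul_sum _ _ (τ : ℂ), ← Finset.sum_add_distrib,
          mul_left_comm Complex.I, mul_div_assoc, ← mul_assoc, Finset.mul_sum, Finset.sum_div,
          Finset.mul_sum]
        refine Finset.sum_congr rfl fun d _ => ?_
        rw [hcod, flow, hy, hdiff τ h hh]
        simp only [w]; ring
      rw [this] at hr
      linear_combination hr / 2
    have hproj : M.ProjectsTo g k τ ↔ r = k / σ ∧ s = k * τ / σ := by
      constructor
      · intro hp
        let F := (G.lift M.base (Quotient.out M.base)).left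
        have h1 := (hp F).1
        have h2 := (hp F).2
        rw [(hrs F).1] at h1
        rw [(hrs F).2] at h2
        exact ⟨add_left_cancel h1, add_left_cancel h2⟩
      · rintro ⟨h1, h2⟩ F
        have := hrs F
        rwa [h1, h2] at this
    rw [hproj, hr', hs', div_left_inj' hσ, div_left_inj' hσ]

end Marking

end TorusDecomposition

/-! ### Minimization over the half-plane and the main theorem. -/

theorem add_div_eq_sqrt_add {a b e x y : ℝ} (he : 0 < e) (hd : 0 < a * e - b ^ 2) (hy : 0 < y) :
    (a + 2 * b * x + e * (x ^ 2 + y ^ 2)) / (2 * y) = √(a * e - b ^ 2) +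
      ((e * x + b) ^ 2 + (e * y - √(a * e - b ^ 2)) ^ 2) / (2 * e * y) := by
  have h := Real.sq_sqrt hd.le
  field_simp
  linear_combination -h

theorem conjugate_periods_iff {a b e k : ℝ} {τ : ℂ} (he : 0 < e) (hd : 0 < a * e - b ^ 2)
    (hk : 0 < k) : (-Complex.I * (b + τ * e) = k ∧ Complex.I * (a + τ * b) = k * τ) ↔
      (e * τ.re + b = 0 ∧ e * τ.im = √(a * e - b ^ 2)) ∧ k = √(a * e - b ^ 2) := by
  have h := Real.sq_sqrt hd.le
  have hK := Real.sqrt_pos.2 hd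
  set K := √(a * e - b ^ 2)
  simp only [Complex.ext_iff]
  simp
  constructor
  · rintro ⟨⟨h1, h2⟩, h3, h4⟩
    have hkK : k = K := by
      -- The first equation says e Re τ = −b and e Im τ = k. Multiplying a + b Re τ = k Im τ, from
      -- the second, by e gives ae − b² = k².
      have : k ^ 2 = K ^ 2 := by
        rw [h]
        linear_combination (-k) * h1 - e * h4 - b * h2
      exact (pow_left_inj₀ hk.le hK.le two_ne_zero).1 this
    exact ⟨⟨by linarith, by linarith⟩, hkK⟩
  · rintro ⟨⟨h1, h2⟩, rfl⟩
    refine ⟨⟨by linarith, by linarith⟩, ?_, ?_⟩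
    · refine mul_left_cancel₀ he.ne' ?_
      linear_combination (-b) * h2 - K * h1
    · refine mul_left_cancel₀ he.ne' ?_
      linear_combination b * h1 - h - K * h2

end

theorem theorem1 {D : Type*} [Finite D] (G : TorusDecomposition D) (M : G.Marking)
    (c : G.Edge → ℝ) (hc : ∀ e, 0 < c e) :
    (∀ τ : UpperHalfPlane, ∃ h, M.IsHarmonicMap c τ h ∧
      ∀ h', M.IsHarmonicMap c τ h' ↔ ∃ t : ℂ, ∀ x, h' x = h x + t) ∧
    (∀ τ h, M.IsHarmonicMap c τ h → ∃ g, TorusDecomposition.IsConjugate c h g) ∧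
    ∃! p : UpperHalfPlane × ℝ, 0 < p.2 ∧
      ((∀ τ h, M.IsMinimizer c τ h ↔ τ = p.1 ∧ M.IsHarmonicMap c τ h) ∧
        ∀ h, M.IsHarmonicMap c p.1 h → TorusDecomposition.energy c h = p.2) ∧
      ∀ τ h g, M.IsHarmonicMap c τ h → TorusDecomposition.IsConjugate c h g →
        ∀ k : ℝ, 0 < k → (M.ProjectsTo g k τ ↔ τ = p.1 ∧ k = p.2) := by
  cases nonempty_fintype D
  have hex : ∀ τ : UpperHalfPlane, ∃ h, M.IsHarmonicMap c τ h ∧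
      ∀ h', M.IsHarmonicMap c τ h' ↔ ∃ t : ℂ, ∀ x, h' x = h x + t := by
    intro τ
    obtain ⟨h, hh, hflow⟩ := M.exists_isMapTo_flow_mem_coclosed hc τ
    exact ⟨h, M.isHarmonicMap_of_flow hc hh hflow, fun _ => M.isHarmonicMap_iff_of_flow hc hh hflow⟩
  refine ⟨hex, fun τ h hh => M.exists_isConjugate hh.1 (hh.flow_mem_coclosed hc), ?_⟩
  obtain ⟨a, b, e, he, hd, henergy, hproj⟩ := M.exists_gram hc
  have hK := Real.sqrt_pos.2 hd
  set K := √(a * e - b ^ 2) with hKdef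
  let τc : UpperHalfPlane := ⟨⟨-b / e, K / e⟩, div_pos hK he⟩
  have hre : τc.re = -b / e := rfl
  have him : τc.im = K / e := rfl
  have hτc : ∀ τ : UpperHalfPlane, τ = τc ↔ e * τ.re + b = 0 ∧ e * τ.im = K := by
    intro τ
    constructor
    · rintro rfl
      rw [hre, him]
      exact ⟨by field_simp; ring, by field_simp⟩
    · rintro ⟨h1, h2⟩
      refine UpperHalfPlane.ext (Complex.ext ?_ ?_)
      · change τ.re = -b / e
        field_simp; linarith
      · change τ.im = K / e
        field_simp; linarith
  have hE : ∀ τ h, M.IsHarmonicMap c τ h → K ≤ TorusDecomposition.energy c h ∧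
      (TorusDecomposition.energy c h ≤ K ↔ τ = τc) := by
    intro τ h hh
    have hden : 0 < 2 * e * τ.im := by have := τ.im_pos; positivity
    rw [henergy τ h hh, add_div_eq_sqrt_add he hd τ.im_pos, ← hKdef, hτc, add_le_iff_nonpos_right,
      div_le_iff₀ hden, zero_mul]
    refine ⟨le_add_of_nonneg_right (by positivity), fun h0 => ?_, fun ⟨h1, h2⟩ => ?_⟩
    · constructor
      · exact pow_eq_zero_iff two_ne_zero |>.1
          (le_antisymm (by nlinarith [sq_nonneg (e * τ.im - K)]) (sq_nonneg _))
      · exact sub_eq_zero.1 (pow_eq_zero_iff two_ne_zero |>.1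
          (le_antisymm (by nlinarith [sq_nonneg (e * τ.re + b)]) (sq_nonneg _)))
    · rw [h1, h2]; simp
  have hEc : ∀ h, M.IsHarmonicMap c τc h → TorusDecomposition.energy c h = K := fun h hh =>
    le_antisymm ((hE τc h hh).2.2 rfl) (hE τc h hh).1
  obtain ⟨hmin, hhmin, -⟩ := hex τc
  have hminimizer : ∀ τ h, M.IsMinimizer c τ h ↔ τ = τc ∧ M.IsHarmonicMap c τ h := by
    intro τ h
    constructor
    · rintro ⟨hh, hle⟩
      have hharm : M.IsHarmonicMap c τ h := ⟨hh, hle τ⟩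
      exact ⟨(hE τ h hharm).2.1 ((hle τc hmin hhmin.1).trans (hEc _ hhmin).le), hharm⟩
    · rintro ⟨rfl, hh⟩
      refine ⟨hh.1, fun τ' h' hh' => ?_⟩
      obtain ⟨k, hk, -⟩ := hex τ'
      exact (hEc h hh).le.trans ((hE τ' k hk).1.trans (hk.2 h' hh'))
  refine ⟨(τc, K), ⟨hK, ⟨hminimizer, hEc⟩, fun τ h g hh hg k hk => ?_⟩, ?_⟩
  · rw [hproj τ h g hh hg k, hτc]
    exact conjugate_periods_iff he hd hk
  -- The minimizer property alone determines the pair: τ' is the modulus of the minimizer and k' its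
  -- energy.
  · rintro ⟨τ', k'⟩ ⟨-, ⟨hmin', hE'⟩, -⟩
    have h1 : τc = τ' := ((hmin' τc hmin).1 ((hminimizer τc hmin).2 ⟨rfl, hhmin⟩)).1
    subst h1
    exact Prod.ext rfl ((hE' hmin hhmin).symm.trans (hEc hmin hhmin))
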